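/- Let $(X,d)$ be a non-empty compact metric space and let $g_1,\dots,g_k:X\to X$ ($k\ge 1$) be continuous surjective maps that are $(a,\lambda)$-Ruelle expanding for some $a>0$, $\lambda\in(0,1)$: whenever $d(x,y)<a$ and $g_i(\tilde x)=x$, there is a unique $\tilde y$ with $g_i(\tilde y)=y$ and $d(\tilde x,\tilde y)<a$, and $d(\tilde x,\tilde y)\le\lambda d(x,y)$. For a finite word $w=i_1\dots i_n$ put $T_w=g_{i_n}\circ\cdots\circ g_{i_1}$, and suppose that the maps are jointly topologically mixing: for all non-empty open $U,V\subset X$ there is $m$ with $T_w^{-1}(U)\cap V\ne\emptyset$ for all words $w$ with $|w|\ge m$. Let $\varphi:X\to\mathbb R$ be $\alpha$-Hölder for some $\alpha\in(0,1]$, with Hölder coefficient $D_\alpha(\varphi)$, and put $\varphi_w=\varphi+\varphi\circ T_{i_1}+\cdots+\varphi\circ T_{i_1\dots i_{n-1}}$. Let $\mathbb G=\{(T_w,\varphi_w): w \text{ a non-empty finite word}\}$, that is, the semigroup generated by $(g_1,\varphi),\dots,(g_k,\varphi)$ under $(g,\psi)*(h,\chi)=(g\circ h,\ \chi+\psi\circ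 h)$. Let $L_w f(x)=\sum_{T_w(y)=x}e^{\varphi_w(y)}f(y)$ and $\mathbb P_u^v f=L_v(f\cdot L_u\mathbf 1)/L_{uv}\mathbf 1$. For a left-infinite word $\sigma=\dots\sigma_2\sigma_1$ and a right-infinite word $\omega=\omega_1\omega_2\dots$, let $\mu_{\sigma,\omega}$ be the probability measure which is the weak limit, as $k,l\to\infty$, of $(\mathbb P_{\sigma_k\dots\sigma_1}^{\omega_1\dots\omega_l})^*\nu$ for every Borel probability measure $\nu$ on $X$. The equilibrium state of $(g,\psi)=(T_w,\varphi_w)\in\mathbb G$ is $\mu_{g,\psi}:=\mu_{\dots ww,\,ww\dots}$. Let $$\kappa(g)=\lim_{\varepsilon\to0}\inf\Big\{\frac{d(g(x),g(y))}{d(x,y)}:0<d(x,y)<\varepsilon\Big\}\in[0,\infty],$$ and let $d_{\mathbb G}((g,\psi),(h,\chi))=\overline W(\mu_{g,\psi},\mu_{h,\chi})+\frac1{\kappa(g)}+\frac1{\kappa(h)}$ for $(g,\psi)\ne(h,\chi)$, and $0$ otherwise, where $\overline W$ is the Vaserstein distance with respect to $d^*(x,y)=\min\{1,\Delta\, d(x,y)^\alpha\}$,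 $\Delta=\max\{4D_\alpha(\varphi)/(1-\lambda^\alpha),a^{-\alpha}\}$. The boundary $\partial\mathbb G$ is the complement of $\mathbb G$ in the completion of $(\mathbb G,d_{\mathbb G})$. **Proposition.** Suppose that $\mathbb G$ is Abelian. Then there is one probability measure $\mu$ such that $\mu_{g,\psi}$ exists, does not depend on the word representing $(g,\psi)$, and equals $\mu$ for every $(g,\psi)\in\mathbb G$, and such that $\mu_{\sigma,\omega}$ exists and equals $\mu$ for all $\sigma,\omega$. If, moreover, $\kappa(g)<\infty$ for all $(g,\psi)\in\mathbb G$ (so that $1/\kappa(g)>0$ and $d_{\mathbb G}$ is a metric), then $\partial\mathbb G$ consists of exactly one point. -/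

import Mathlib

open Filter Topology MeasureTheory ProbabilityTheory

noncomputable section

namespace RuelleSemigroup

universe u v

/-! ### Pairs consisting of a map and a potential, and their Ruelle operators -/

/-- A pair `(g, ψ)` of a self-map of `X` and a real potential on `X`. -/
@[ext]
structure Pair (X : Type u) where
  map : X → X
  pot : X → ℝ

namespace Pair

variable {X : Type u}

/-- The product `(g₁, ψ₁) ∗ (g₂, ψ₂) = (g₁ ∘ g₂, ψ₂ + ψ₁ ∘ g₂)`. -/
instance : Mul (Pair X) :=
  ⟨fun p q => ⟨p.map ∘ q.map, fun x => q.pot x + p.pot (q.map x)⟩⟩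

instance : Semigroup (Pair X) where
  mul_assoc p q r := by
    apply Pair.ext
    · rfl
    · funext x
      exact (add_assoc (r.pot x) (q.pot (r.map x)) (p.pot (q.map (r.map x)))).symm

/-- The Ruelle operator `L_{(g, ψ)} f (x) = ∑_{g y = x} exp (ψ y) f y`. -/
def ruelle (p : Pair X) (f : X → ℝ) (x : X) : ℝ :=
  ∑' y : p.map ⁻¹' {x}, Real.exp (p.pot y) * f y

end Pair

/-! ### The standing assumptions -/

/-- The map `T` of the metric space `X` is `(a, lam)`-Ruelle-expanding. -/
def IsRuelleExpanding {X : Type u} [MetricSpace X] (a lam : ℝ) (T : X → X) : Prop :=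
  ∀ x y x' : X, dist x y < a → T x' = x →
    ∃ y' : X, (T y' = y ∧ dist x' y' < a) ∧
      (∀ z : X, T z = y ∧ dist x' z < a → z = y') ∧ dist x' y' ≤ lam * dist x y

/-- For a finite word `w = i₁ i₂ … i_k`, the composition `T_w = T_{i_k} ∘ ⋯ ∘ T_{i₁}`. -/
def wordMap {X : Type u} {ι : Type v} (T : ι → X → X) : List ι → X → X
  | [] => id
  | i :: w => wordMap T w ∘ T i

/-- For every pair of non-empty open sets `U`, `V`, the set `T_w⁻¹ U ∩ V` is non-empty
for all sufficiently long words `w`. -/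
def IsJointlyMixing {X : Type u} {ι : Type v} [MetricSpace X] (T : ι → X → X) : Prop :=
  ∀ U V : Set X, IsOpen U → U.Nonempty → IsOpen V → V.Nonempty →
    ∃ m : ℕ, ∀ w : List ι, m ≤ w.length → (wordMap T w ⁻¹' U ∩ V).Nonempty

/-- The Hölder quotients of `f`; their supremum is the Hölder coefficient of `f`. -/
def holderQuotients {X : Type u} [MetricSpace X] (alpha : ℝ) (f : X → ℝ) : Set ℝ :=
  {r | ∃ x y : X, x ≠ y ∧ r = |f x - f y| / dist x y ^ alpha}

/-- A family `T i`, `i : ι`, of continuous surjective Ruelle expanding maps of `X` which is jointly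
topologically mixing, together with one Hölder continuous potential, and the parameters `a`, `lam`
of expansion and the Hölder exponent `alpha`. -/
structure System (X : Type u) (ι : Type v) [MetricSpace X] where
  T : ι → X → X
  pot : X → ℝ
  a : ℝ
  lam : ℝ
  alpha : ℝ
  continuous_T : ∀ i, Continuous (T i)
  surjective_T : ∀ i, Function.Surjective (T i)
  a_pos : 0 < a
  lam_pos : 0 < lam
  lam_lt_one : lam < 1
  alpha_pos : 0 < alpha
  alpha_le_one : alpha ≤ 1
  expanding : ∀ i, IsRuelleExpanding a lam (T i)
  mixing : IsJointlyMixing T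
  holder : BddAbove (holderQuotients alpha pot)

/-! ### Words -/

/-- The word `[ω]_l = i₁ … i_l` of a right-infinite word `ω = i₁ i₂ …` (with `i_{j+1} = ω j`). -/
def rightWord {ι : Type v} (ω : ℕ → ι) (l : ℕ) : List ι := (List.range l).map ω

/-- The word `_k[σ] = i_k … i₁` of a left-infinite word `σ = … i₂ i₁` (with `i_{j+1} = σ j`). -/
def leftWord {ι : Type v} (σ : ℕ → ι) (k : ℕ) : List ι := ((List.range k).map σ).reverse

/-- The periodic word `w w w …`, for a non-empty word `w`. -/
def rightPeriodic {ι : Type v} (w : List ι) (hw : w ≠ []) (n : ℕ) : ι :=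
  w[n % w.length]'(Nat.mod_lt n (List.length_pos_of_ne_nil hw))

/-- The periodic left-infinite word `… w w w`, for a non-empty word `w`. -/
def leftPeriodic {ι : Type v} (w : List ι) (hw : w ≠ []) : ℕ → ι :=
  rightPeriodic w.reverse (by simpa using hw)

/-- The expansion constant `κ(g) = lim_{ε → 0} inf {d(g x, g y) / d(x, y) : 0 < d(x, y) < ε}`, with
values in `[0, ∞]`. The infimum increases as `ε` decreases, so the limit is a supremum. -/
def kappa {X : Type u} [MetricSpace X] (g : X → X) : ENNReal :=
  ⨆ (ε : ENNReal) (_ : 0 < ε), ⨅ (x : X) (y : X) (_ : 0 < edist x y) (_ : edist x y < ε),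
    edist (g x) (g y) / edist x y

/-- The probability measures on `X × X` with marginals `μ` and `ν`. -/
def couplings {X : Type u} [MeasurableSpace X] (μ ν : ProbabilityMeasure X) :
    Set (Measure (X × X)) :=
  {Q | IsProbabilityMeasure Q ∧ Q.map Prod.fst = μ ∧ Q.map Prod.snd = ν}

namespace System

section Basic

variable {X : Type u} {ι : Type v} [MetricSpace X] (S : System X ι)

/-- `φ_w = φ + φ ∘ T_{i₁} + ⋯ + φ ∘ T_{i₁ … i_{k-1}}` for a finite word `w = i₁ … i_k`. -/
def wordPot : List ι → X → ℝ
  | [] => fun _ => 0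
  | i :: w => fun x => S.pot x + wordPot w (S.T i x)

/-- The pair `(T_w, φ_w)`. -/
def wordPair (w : List ι) : Pair X := ⟨wordMap S.T w, S.wordPot w⟩

/-- The Ruelle operator `L_w`. -/
def L (w : List ι) : (X → ℝ) → X → ℝ := (S.wordPair w).ruelle

/-- The normalised operator `ℙ_u^v f = L_v (f · L_u 1) / L_{uv} 1`. -/
def P (u v : List ι) (f : X → ℝ) (x : X) : ℝ :=
  S.L v (fun y => f y * S.L u (fun _ => 1) y) x / S.L (u ++ v) (fun _ => 1) x

/-- The semigroup `𝔾` of pairs generated by the pairs `(T i, φ)`. -/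
def G : Subsemigroup (Pair X) :=
  Subsemigroup.closure (Set.range fun i => (⟨S.T i, S.pot⟩ : Pair X))

/-- The constant `C_φ = D_α(φ) / (1 - λ^α)`. -/
def distortion : ℝ := sSup (holderQuotients S.alpha S.pot) / (1 - S.lam ^ S.alpha)

/-- The constant `Δ = max {4 C_φ, a^{-α}}`. -/
def Delta : ℝ := max (4 * S.distortion) (S.a ^ (-S.alpha))

/-- The truncated distance `d*(x, y) = min {1, Δ d(x, y)^α}`. -/
def dstar (x y : X) : ℝ := min 1 (S.Delta * dist x y ^ S.alpha)

theorem Delta_nonneg : 0 ≤ S.Delta :=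
  le_trans (Real.rpow_nonneg S.a_pos.le _) (le_max_right _ _)

theorem dstar_nonneg (x y : X) : 0 ≤ S.dstar x y :=
  le_min zero_le_one (mul_nonneg S.Delta_nonneg (Real.rpow_nonneg dist_nonneg _))

theorem dstar_le_one (x y : X) : S.dstar x y ≤ 1 := min_le_left _ _

theorem dstar_comm (x y : X) : S.dstar x y = S.dstar y x := by
  simp only [dstar, dist_comm]

theorem dstar_triangle (x y z : X) : S.dstar x z ≤ S.dstar x y + S.dstar y z := by
  have h1 : dist x z ^ S.alpha ≤ dist x y ^ S.alpha + dist y z ^ S.alpha :=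
    (Real.rpow_le_rpow dist_nonneg (dist_triangle x y z) S.alpha_pos.le).trans
      (Real.rpow_add_le_add_rpow dist_nonneg dist_nonneg S.alpha_pos.le S.alpha_le_one)
  have h2 := mul_le_mul_of_nonneg_left h1 S.Delta_nonneg
  have h3 : 0 ≤ S.Delta * dist x y ^ S.alpha :=
    mul_nonneg S.Delta_nonneg (Real.rpow_nonneg dist_nonneg _)
  have h4 : 0 ≤ S.Delta * dist y z ^ S.alpha :=
    mul_nonneg S.Delta_nonneg (Real.rpow_nonneg dist_nonneg _)
  unfold dstar
  rcases min_cases (1 : ℝ) (S.Delta * dist x y ^ S.alpha) with h5 | h5 <;>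
  rcases min_cases (1 : ℝ) (S.Delta * dist y z ^ S.alpha) with h6 | h6 <;>
  rw [h5.1, h6.1]
  · linarith [min_le_left (1 : ℝ) (S.Delta * dist x z ^ S.alpha)]
  · linarith [min_le_left (1 : ℝ) (S.Delta * dist x z ^ S.alpha)]
  · linarith [min_le_left (1 : ℝ) (S.Delta * dist x z ^ S.alpha)]
  · linarith [min_le_right (1 : ℝ) (S.Delta * dist x z ^ S.alpha)]

theorem continuous_dstar : Continuous fun q : X × X => S.dstar q.1 q.2 := by
  unfold dstar
  exact continuous_const.min
    (continuous_const.mul (continuous_dist.rpow_const fun _ => Or.inr S.alpha_pos.le))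

end Basic

section Measures

variable {X : Type u} {ι : Type v} [MetricSpace X] [MeasurableSpace X] (S : System X ι)

/-- `μ` is the measure `μ_{σ,ω}`: the weak limit, as `k, l → ∞`, of `(ℙ_{_k[σ]}^{[ω]_l})^* ν`
for every Borel probability measure `ν`. -/
def IsQuenchedLimit (σ ω : ℕ → ι) (μ : ProbabilityMeasure X) : Prop :=
  ∀ (ν : ProbabilityMeasure X) (f : X → ℝ), Continuous f →
    Tendsto (fun n : ℕ × ℕ => ∫ x, S.P (leftWord σ n.1) (rightWord ω n.2) f x ∂(ν : Measure X))
      atTop (𝓝 (∫ x, f x ∂(μ : Measure X)))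

/-- `μ` is the equilibrium state `μ_{g,ψ}` of `p = (g, ψ)`, that is, `μ = μ_{σ,ω}` where
`σ = … w w`, `ω = w w …` for a word `w` with `(g, ψ) = (T_w, φ_w)`. -/
def IsEquilibriumState (p : Pair X) (μ : ProbabilityMeasure X) : Prop :=
  ∃ (w : List ι) (hw : w ≠ []), p = S.wordPair w ∧
    S.IsQuenchedLimit (leftPeriodic w hw) (rightPeriodic w hw) μ

/-- The equilibrium state `μ_{g,ψ}` of `p = (g, ψ)`. -/
def eqState [Nonempty X] (p : Pair X) : ProbabilityMeasure X :=
  @Classical.epsilon _ ⟨⟨Measure.dirac (Classical.arbitrary X), inferInstance⟩⟩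
    (S.IsEquilibriumState p)

/-- The Vaserstein distance with respect to `d*`. -/
def Wbar (μ ν : ProbabilityMeasure X) : ℝ :=
  sInf ((fun Q : Measure (X × X) => ∫ q, S.dstar q.1 q.2 ∂Q) '' couplings μ ν)

end Measures

section Triangle

theorem couplings_nonempty {X : Type u} [MeasurableSpace X] (μ ν : ProbabilityMeasure X) :
    (couplings μ ν).Nonempty :=
  ⟨(μ : Measure X).prod ν, inferInstance, by simp, by simp⟩

variable {X : Type u} {ι : Type v} [MetricSpace X] [MeasurableSpace X] (S : System X ι)

theorem Wbar_bddBelow (μ ν : ProbabilityMeasure X) :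
    BddBelow ((fun Q : Measure (X × X) => ∫ q, S.dstar q.1 q.2 ∂Q) '' couplings μ ν) := by
  refine ⟨0, ?_⟩
  rintro r ⟨Q, -, rfl⟩
  exact integral_nonneg fun q => S.dstar_nonneg _ _

theorem Wbar_nonneg (μ ν : ProbabilityMeasure X) : 0 ≤ S.Wbar μ ν := by
  refine Real.sInf_nonneg ?_
  rintro r ⟨Q, -, rfl⟩
  exact integral_nonneg fun q => S.dstar_nonneg _ _

variable [CompactSpace X] [BorelSpace X]

theorem integrable_dstar {Y : Type*} [MeasurableSpace Y] (Q : Measure Y) [IsFiniteMeasure Q]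
    {f g : Y → X} (hf : Measurable f) (hg : Measurable g) :
    Integrable (fun y => S.dstar (f y) (g y)) Q := by
  have hm : Measurable fun y => S.dstar (f y) (g y) :=
    S.continuous_dstar.measurable.comp (hf.prodMk hg)
  refine Integrable.of_bound hm.aestronglyMeasurable 1 (Eventually.of_forall fun y => ?_)
  rw [Real.norm_of_nonneg (S.dstar_nonneg _ _)]
  exact S.dstar_le_one _ _

theorem Wbar_le_swap (μ ν : ProbabilityMeasure X) : S.Wbar μ ν ≤ S.Wbar ν μ := by
  refine le_csInf ((couplings_nonempty ν μ).image _) ?_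
  rintro r ⟨Q, ⟨hQ, h1, h2⟩, rfl⟩
  refine csInf_le (S.Wbar_bddBelow μ ν) ⟨Q.map Prod.swap, ⟨?_, ?_, ?_⟩, ?_⟩
  · exact Measure.isProbabilityMeasure_map measurable_swap.aemeasurable
  · rw [Measure.map_map measurable_fst measurable_swap]; exact h2
  · rw [Measure.map_map measurable_snd measurable_swap]; exact h1
  · show ∫ q, S.dstar q.1 q.2 ∂(Q.map Prod.swap) = ∫ q, S.dstar q.1 q.2 ∂Q
    rw [integral_map measurable_swap.aemeasurable
      S.continuous_dstar.measurable.aestronglyMeasurable]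
    exact integral_congr_ae (Eventually.of_forall fun q => S.dstar_comm _ _)

theorem Wbar_comm (μ ν : ProbabilityMeasure X) : S.Wbar μ ν = S.Wbar ν μ :=
  le_antisymm (S.Wbar_le_swap μ ν) (S.Wbar_le_swap ν μ)

/-- Gluing of two couplings along their common marginal. -/
theorem exists_gluing [Nonempty X] {μ ν ρ : ProbabilityMeasure X} {Q Q' : Measure (X × X)}
    (hQ : Q ∈ couplings ν μ) (hQ' : Q' ∈ couplings ν ρ) :
    ∃ M : Measure (X × X × X), IsProbabilityMeasure M ∧
      M.map (fun q => (q.1, q.2.1)) = Q ∧ M.map (fun q => (q.1, q.2.2)) = Q' := by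
  obtain ⟨hQ0, hQ1, hQ2⟩ := hQ
  obtain ⟨hQ'0, hQ'1, hQ'2⟩ := hQ'
  refine ⟨(ν : Measure X) ⊗ₘ (Q.condKernel ×ₖ Q'.condKernel), inferInstance, ?_, ?_⟩
  · have h := Measure.compProd_map (μ := (ν : Measure X))
      (κ := Q.condKernel ×ₖ Q'.condKernel) measurable_fst
    rw [← Kernel.fst_eq, Kernel.fst_prod] at h
    have h' : Q.fst ⊗ₘ Q.condKernel = Q := Measure.disintegrate _ _
    rw [Measure.fst, hQ1] at h'
    exact h.symm.trans h'
  · have h := Measure.compProd_map (μ := (ν : Measure X))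
      (κ := Q.condKernel ×ₖ Q'.condKernel) measurable_snd
    rw [← Kernel.snd_eq, Kernel.snd_prod] at h
    have h' : Q'.fst ⊗ₘ Q'.condKernel = Q' := Measure.disintegrate _ _
    rw [Measure.fst, hQ'1] at h'
    exact h.symm.trans h'

theorem Wbar_triangle [Nonempty X] (μ ν ρ : ProbabilityMeasure X) :
    S.Wbar μ ρ ≤ S.Wbar μ ν + S.Wbar ν ρ := by
  rw [S.Wbar_comm μ ν, ← sub_le_iff_le_add']
  refine le_csInf ((couplings_nonempty ν ρ).image _) ?_
  rintro r ⟨Q', hQ', rfl⟩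
  rw [sub_le_iff_le_add, ← sub_le_iff_le_add']
  refine le_csInf ((couplings_nonempty ν μ).image _) ?_
  rintro r ⟨Q, hQ, rfl⟩
  rw [sub_le_iff_le_add]
  obtain ⟨M, hM, hMQ, hMQ'⟩ := exists_gluing hQ hQ'
  have m1 : Measurable fun q : X × X × X => (q.1, q.2.1) := by fun_prop
  have m2 : Measurable fun q : X × X × X => (q.1, q.2.2) := by fun_prop
  have hd := S.continuous_dstar.measurable
  have e1 : M.map Prod.snd ∈ couplings μ ρ := by
    refine ⟨Measure.isProbabilityMeasure_map measurable_snd.aemeasurable, ?_, ?_⟩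
    · rw [Measure.map_map measurable_fst measurable_snd, ← hQ.2.2, ← hMQ,
        Measure.map_map measurable_snd m1]
      rfl
    · rw [Measure.map_map measurable_snd measurable_snd, ← hQ'.2.2, ← hMQ',
        Measure.map_map measurable_snd m2]
      rfl
  refine (csInf_le (S.Wbar_bddBelow μ ρ) ⟨_, e1, rfl⟩).trans ?_
  show (∫ q, S.dstar q.1 q.2 ∂(M.map Prod.snd)) ≤
    (∫ q, S.dstar q.1 q.2 ∂Q) + (∫ q, S.dstar q.1 q.2 ∂Q')
  rw [← hMQ, ← hMQ', integral_map measurable_snd.aemeasurable hd.aestronglyMeasurable,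
    integral_map m1.aemeasurable hd.aestronglyMeasurable,
    integral_map m2.aemeasurable hd.aestronglyMeasurable,
    ← integral_add (S.integrable_dstar M (by fun_prop) (by fun_prop))
      (S.integrable_dstar M (by fun_prop) (by fun_prop))]
  refine integral_mono (S.integrable_dstar M (by fun_prop) (by fun_prop))
    ((S.integrable_dstar M (by fun_prop) (by fun_prop)).add
      (S.integrable_dstar M (by fun_prop) (by fun_prop))) fun q => ?_
  have h := S.dstar_triangle q.2.1 q.1 q.2.2
  rw [S.dstar_comm q.2.1 q.1] at h
  exact h

end Triangle

/-! ### The metric on `𝔾` and the boundary of the completion -/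

section Boundary

variable {X : Type u} {ι : Type v} [MetricSpace X] [MeasurableSpace X] [Nonempty X]
  (S : System X ι)

open Classical in
/-- `d_𝔾((g, ψ), (h, χ)) = W̄(μ_{g,ψ}, μ_{h,χ}) + 1 / κ(g) + 1 / κ(h)` for `(g, ψ) ≠ (h, χ)`, and `0`
otherwise. -/
def distG (p q : S.G) : ℝ :=
  if p = q then 0
  else S.Wbar (S.eqState p) (S.eqState q) + (kappa (p : Pair X).map)⁻¹.toReal +
    (kappa (q : Pair X).map)⁻¹.toReal

variable [CompactSpace X] [BorelSpace X]

instance pseudoMetricSpaceG : PseudoMetricSpace S.G where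
  dist := S.distG
  dist_self p := by
    show S.distG p p = 0
    simp [distG]
  dist_comm p q := by
    show S.distG p q = S.distG q p
    unfold distG
    by_cases h : p = q
    · simp [h]
    · rw [if_neg h, if_neg (Ne.symm h), S.Wbar_comm]
      ring
  dist_triangle p q r := by
    show S.distG p r ≤ S.distG p q + S.distG q r
    have hk : ∀ s : S.G, 0 ≤ (kappa (s : Pair X).map)⁻¹.toReal := fun s => ENNReal.toReal_nonneg
    by_cases h1 : p = q
    · subst h1; simp [distG]
    by_cases h2 : q = r
    · subst h2; simp [distG]
    have h3 := S.Wbar_triangle (S.eqState p) (S.eqState q) (S.eqState r)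
    have h4 := S.Wbar_nonneg (S.eqState p) (S.eqState q)
    have h5 := S.Wbar_nonneg (S.eqState q) (S.eqState r)
    have := hk p
    have := hk q
    have := hk r
    unfold distG
    rw [if_neg h1, if_neg h2]
    by_cases h : p = r
    · rw [if_pos h]; linarith
    · rw [if_neg h]; linarith

/-- The boundary `∂𝔾`: the points which the completion of `(𝔾, d_𝔾)` adds to `𝔾`. -/
def boundary : Set (UniformSpace.Completion S.G) :=
  (Set.range ((↑) : S.G → UniformSpace.Completion S.G))ᶜ

end Boundary

end System

end RuelleSemigroup

end

noncomputable section

namespace RuelleSemigroup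

universe u v

variable {X : Type u} {ι : Type v}

/-! `P u v f x` is a weighted average of `f` over the finite fibre of `T_v` above `x`; the word `u`
enters only through the function `Z u = L_u 1`. Everything reduces to one uniform estimate,
`exists_P_sub_P_le`: for continuous `f`, the values `P u v f x` are nearly independent of `u`, `v`
and `x` once both words are long.

Independence of `x` (`exists_P_sub_le`) needs no commutativity. It is a Doeblin argument: by mixing,
any two points have preimages close to each other under a word of fixed length, these carry weights
bounded below, and the averages stay equicontinuous by bounded distortion. Independence of `v`
(`exists_P_sub_P_le_right`) holds because `P u (v ++ v') = P u (v' ++ v)` is an average both of the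
nearly constant `P u v f` and of the nearly constant `P u v' f`. For independence of `u`
(`exists_P_sub_P_le_left`), the quotient of `Z (u' ++ u)` by `Z u` is itself such an average, hence
nearly constant; as `Z (u' ++ u) = Z (u ++ u')`, the functions `Z u` and `Z u'` are nearly
proportional.

Compactness of the space of probability measures turns the common limit into a measure `μ`
(`exists_limit`). All equilibrium states then agree, so distinct elements of `𝔾` have distance
`1/κ(g) + 1/κ(h)`. Every element is isolated, `1/κ(T_w) ≤ λ^|w|` tends to `0` along long words, and
all Cauchy sequences with `1/κ → 0` are equivalent; they give the single boundary point. -/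

theorem wordMap_append (T : ι → X → X) (u v : List ι) (x : X) :
    wordMap T (u ++ v) x = wordMap T v (wordMap T u x) := by
  induction u generalizing x with
  | nil => rfl
  | cons i u ih => exact ih (T i x)

namespace System

variable [MetricSpace X] (S : System X ι)

theorem wordPot_append (u v : List ι) (x : X) :
    S.wordPot (u ++ v) x = S.wordPot u x + S.wordPot v (wordMap S.T u x) := by
  induction u generalizing x with
  | nil => exact (zero_add _).symm
  | cons i u ih =>
    show S.pot x + S.wordPot (u ++ v) (S.T i x) = S.pot x + S.wordPot u (S.T i x) + _
    rw [ih, add_assoc]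
    rfl

theorem wordPair_append (u v : List ι) :
    S.wordPair (u ++ v) = S.wordPair v * S.wordPair u :=
  Pair.ext (funext fun x => wordMap_append S.T u v x) (funext fun x => S.wordPot_append u v x)

theorem surjective_wordMap (w : List ι) : Function.Surjective (wordMap S.T w) := by
  induction w with
  | nil => exact Function.surjective_id
  | cons i w ih => exact ih.comp (S.surjective_T i)

theorem wordPair_mem_G {w : List ι} (hw : w ≠ []) : S.wordPair w ∈ S.G := by
  have single : ∀ i, S.wordPair [i] ∈ S.G := fun i => by
    refine Subsemigroup.subset_closure ⟨i, Pair.ext rfl (funext fun x => ?_)⟩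
    exact (add_zero (S.pot x)).symm
  induction w with
  | nil => exact absurd rfl hw
  | cons i w ih =>
    rcases eq_or_ne w [] with rfl | h
    · exact single i
    · have := S.wordPair_append [i] w
      rw [List.singleton_append] at this
      rw [this]
      exact S.G.mul_mem (ih h) (single i)

theorem exists_word_of_mem_G {p : Pair X} (hp : p ∈ S.G) :
    ∃ w : List ι, w ≠ [] ∧ p = S.wordPair w := by
  induction hp using Subsemigroup.closure_induction with
  | mem p hp =>
    obtain ⟨i, rfl⟩ := hp
    exact ⟨[i], by simp, Pair.ext rfl (funext fun x => (add_zero (S.pot x)).symm)⟩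
  | mul p q _ _ hp hq =>
    obtain ⟨u, hu, rfl⟩ := hp
    obtain ⟨v, hv, rfl⟩ := hq
    exact ⟨v ++ u, by simp [hu], (S.wordPair_append v u).symm⟩

/-! ### Orbits that stay close to each other -/

/-- The orbits of `x` and `y` along the word `w` stay at distance less than `a`. -/
def Matched : List ι → X → X → Prop
  | [], x, y => dist x y < S.a
  | i :: w, x, y => dist x y < S.a ∧ Matched w (S.T i x) (S.T i y)

variable {S}

theorem Matched.dist_lt {w : List ι} {x y : X} (h : S.Matched w x y) : dist x y < S.a := by
  cases w with
  | nil => exact h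
  | cons i w => exact h.1

theorem Matched.symm {w : List ι} {x y : X} (h : S.Matched w x y) : S.Matched w y x := by
  induction w generalizing x y with
  | nil => exact (dist_comm y x).trans_lt h
  | cons i w ih => exact ⟨(dist_comm y x).trans_lt h.1, ih h.2⟩

theorem eq_of_dist_lt {i : ι} {x y z : X} (h : S.T i y = S.T i z) (hxy : dist x y < S.a)
    (hxz : dist x z < S.a) (hT : dist (S.T i x) (S.T i y) < S.a) : y = z := by
  obtain ⟨t, -, ht, -⟩ := S.expanding i (S.T i x) (S.T i y) x hT rfl
  rw [ht y ⟨rfl, hxy⟩, ht z ⟨h.symm, hxz⟩]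

/-- By uniqueness of the nearby preimage, `y` is the point supplied by the expansion property and
inherits its contraction bound. -/
theorem dist_le_of_dist_lt {i : ι} {x y : X} (hxy : dist x y < S.a)
    (hT : dist (S.T i x) (S.T i y) < S.a) : dist x y ≤ S.lam * dist (S.T i x) (S.T i y) := by
  obtain ⟨t, -, ht, hd⟩ := S.expanding i (S.T i x) (S.T i y) x hT rfl
  rwa [← ht y ⟨rfl, hxy⟩] at hd

theorem Matched.dist_le {w : List ι} {x y : X} (h : S.Matched w x y) :
    dist x y ≤ S.lam ^ w.length * dist (wordMap S.T w x) (wordMap S.T w y) := by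
  induction w generalizing x y with
  | nil => simp [wordMap]
  | cons i w ih =>
    refine (dist_le_of_dist_lt h.1 h.2.dist_lt).trans ?_
    rw [List.length_cons, pow_succ', mul_assoc]
    exact mul_le_mul_of_nonneg_left (ih h.2) S.lam_pos.le

theorem Matched.eq_of_wordMap_eq {w : List ι} {x y z : X} (hy : S.Matched w x y)
    (hz : S.Matched w x z) (h : wordMap S.T w y = wordMap S.T w z) : y = z := by
  induction w generalizing x y z with
  | nil => exact h
  | cons i w ih => exact eq_of_dist_lt (ih hy.2 hz.2 h) hy.1 hz.1 hy.2.dist_lt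

variable (S)

/-- The target is pulled back one letter at a time, starting from the last; contraction keeps every
intermediate distance below `a`. -/
theorem exists_matched (w : List ι) {x y : X} (h : dist (wordMap S.T w x) y < S.a) :
    ∃ z, wordMap S.T w z = y ∧ S.Matched w x z := by
  induction w generalizing x y with
  | nil => exact ⟨y, rfl, h⟩
  | cons i w ih =>
    obtain ⟨t, rfl, hm⟩ := ih (x := S.T i x) h
    obtain ⟨z, ⟨rfl, hd⟩, -⟩ := S.expanding i (S.T i x) t x hm.dist_lt rfl
    exact ⟨z, rfl, hd, hm⟩

theorem lam_pow_le_one (n : ℕ) : S.lam ^ n ≤ 1 := pow_le_one₀ S.lam_pos.le S.lam_lt_one.le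

/-- The Hölder coefficient of the potential. -/
def coeff : ℝ := sSup (holderQuotients S.alpha S.pot)

theorem coeff_nonneg : 0 ≤ S.coeff := by
  refine Real.sSup_nonneg ?_
  rintro r ⟨x, y, -, rfl⟩
  positivity

theorem abs_pot_sub_le (x y : X) : |S.pot x - S.pot y| ≤ S.coeff * dist x y ^ S.alpha := by
  rcases eq_or_ne x y with rfl | h
  · simp [Real.zero_rpow S.alpha_pos.ne']
  · rw [← div_le_iff₀ (Real.rpow_pos_of_pos (dist_pos.2 h) _)]
    exact le_csSup S.holder ⟨x, y, h, rfl⟩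

theorem lam_rpow_lt_one : S.lam ^ S.alpha < 1 :=
  Real.rpow_lt_one S.lam_pos.le S.lam_lt_one S.alpha_pos

theorem distortion_nonneg : 0 ≤ S.distortion :=
  div_nonneg S.coeff_nonneg (sub_nonneg.2 S.lam_rpow_lt_one.le)

variable {S}

theorem Matched.abs_wordPot_sub_le {w : List ι} {x y : X} (h : S.Matched w x y) :
    |S.wordPot w x - S.wordPot w y| ≤
      S.distortion * dist (wordMap S.T w x) (wordMap S.T w y) ^ S.alpha := by
  set r := S.lam ^ S.alpha with hr
  have hr0 : 0 < r := Real.rpow_pos_of_pos S.lam_pos _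
  have hr1 : r < 1 := S.lam_rpow_lt_one
  have hC : S.distortion * (1 - r) = S.coeff := div_mul_cancel₀ _ (sub_pos.2 hr1).ne'
  -- The partial geometric sum lets the induction close: `C (1 - r) r ^ n + C (1 - r ^ n) = C (1 - r
  -- ^ (n + 1))`.
  suffices H : |S.wordPot w x - S.wordPot w y| ≤ S.distortion * (1 - r ^ w.length) *
      dist (wordMap S.T w x) (wordMap S.T w y) ^ S.alpha by
    refine H.trans (mul_le_mul_of_nonneg_right ?_ (by positivity))
    exact mul_le_of_le_one_right S.distortion_nonneg (sub_le_self _ (by positivity))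
  induction w generalizing x y with
  | nil => simp [wordPot]
  | cons i w ih =>
    set D := dist (wordMap S.T (i :: w) x) (wordMap S.T (i :: w) y) with hD
    have hD0 : 0 ≤ D := dist_nonneg
    have h1 : |S.pot x - S.pot y| ≤ S.coeff * (r ^ w.length * D ^ S.alpha) := by
      refine (S.abs_pot_sub_le x y).trans (mul_le_mul_of_nonneg_left ?_ S.coeff_nonneg)
      have h2 := Real.rpow_le_rpow dist_nonneg h.dist_le S.alpha_pos.le
      rw [Real.mul_rpow (by have := S.lam_pos; positivity) dist_nonneg, ← Real.rpow_natCast,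
        ← Real.rpow_mul S.lam_pos.le, mul_comm _ S.alpha, Real.rpow_mul S.lam_pos.le,
        Real.rpow_natCast] at h2
      refine h2.trans (mul_le_mul_of_nonneg_right ?_ (by positivity))
      exact pow_le_pow_of_le_one hr0.le hr1.le (by simp)
    have h3 := ih h.2
    have h4 : |S.wordPot (i :: w) x - S.wordPot (i :: w) y| ≤ |S.pot x - S.pot y| +
        |S.wordPot w (S.T i x) - S.wordPot w (S.T i y)| := by
      refine le_trans (le_of_eq ?_) (abs_add_le _ _)
      simp only [wordPot]
      congr 1
      ring
    refine (h4.trans (add_le_add h1 h3)).trans (le_of_eq ?_)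
    rw [← hC, List.length_cons, hD]
    simp only [wordMap, Function.comp_apply]
    ring

variable (S)

/-- The bound for the distortion of the weights at the points `x` and `y`. -/
def distortionAt (x y : X) : ℝ := S.distortion * dist x y ^ S.alpha

theorem distortionAt_comm (x y : X) : S.distortionAt x y = S.distortionAt y x := by
  simp only [distortionAt, dist_comm]

theorem distortionAt_nonneg (x y : X) : 0 ≤ S.distortionAt x y :=
  mul_nonneg S.distortion_nonneg (Real.rpow_nonneg dist_nonneg _)

theorem distortionAt_mono {x y x' y' : X} (h : dist x y ≤ dist x' y') :
    S.distortionAt x y ≤ S.distortionAt x' y' :=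
  mul_le_mul_of_nonneg_left (Real.rpow_le_rpow dist_nonneg h S.alpha_pos.le) S.distortion_nonneg

end System

/-- Comparison of two averages of `f` whose weights dominate a common weight `m`. -/
theorem sum_mul_sub_sum_mul_le {J : Type*} (s : Finset J) (A B : Finset X) {p q f : X → ℝ}
    {a b : J → X} {m : J → ℝ} {lo D : ℝ} (ha : Set.InjOn a s) (hb : Set.InjOn b s)
    (haA : ∀ j ∈ s, a j ∈ A) (hbB : ∀ j ∈ s, b j ∈ B)
    (hp : ∀ y ∈ A, 0 ≤ p y) (hq : ∀ y ∈ B, 0 ≤ q y)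
    (hp1 : ∑ y ∈ A, p y = 1) (hq1 : ∑ y ∈ B, q y = 1)
    (hmp : ∀ j ∈ s, m j ≤ p (a j)) (hmq : ∀ j ∈ s, m j ≤ q (b j))
    (hlo : ∀ y, lo ≤ f y) (hhi : ∀ y, f y ≤ lo + D) :
    ∑ y ∈ A, p y * f y - ∑ y ∈ B, q y * f y ≤
      ∑ j ∈ s, m j * (f (a j) - f (b j)) + (1 - ∑ j ∈ s, m j) * D := by
  classical
  -- The mass not covered by `m` is charged at the top value `lo + D` on the `A` side, and in `h2`
  -- at the bottom value `lo` on the `B` side.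
  have h1 : ∑ j ∈ s, m j * (lo + D - f (a j)) ≤ ∑ y ∈ A, p y * (lo + D - f y) := by
    calc _ ≤ ∑ j ∈ s, p (a j) * (lo + D - f (a j)) := Finset.sum_le_sum fun j hj =>
          mul_le_mul_of_nonneg_right (hmp j hj) (sub_nonneg.2 (hhi _))
      _ = ∑ y ∈ s.image a, p y * (lo + D - f y) :=
        (Finset.sum_image (f := fun y => p y * (lo + D - f y)) ha).symm
      _ ≤ _ := Finset.sum_le_sum_of_subset_of_nonneg (Finset.image_subset_iff.2 haA)
          fun y hy _ => mul_nonneg (hp y hy) (sub_nonneg.2 (hhi _))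
  have h2 : ∑ j ∈ s, m j * (f (b j) - lo) ≤ ∑ y ∈ B, q y * (f y - lo) := by
    calc _ ≤ ∑ j ∈ s, q (b j) * (f (b j) - lo) := Finset.sum_le_sum fun j hj =>
          mul_le_mul_of_nonneg_right (hmq j hj) (sub_nonneg.2 (hlo _))
      _ = ∑ y ∈ s.image b, q y * (f y - lo) :=
        (Finset.sum_image (f := fun y => q y * (f y - lo)) hb).symm
      _ ≤ _ := Finset.sum_le_sum_of_subset_of_nonneg (Finset.image_subset_iff.2 hbB)
          fun y hy _ => mul_nonneg (hq y hy) (sub_nonneg.2 (hlo _))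
  simp only [mul_sub, mul_add, Finset.sum_sub_distrib, Finset.sum_add_distrib,
    ← Finset.sum_mul, hp1, hq1, one_mul] at h1 h2 ⊢
  linarith

/-- A function with oscillation at most `D` takes its values in an interval of length `D`. -/
theorem exists_forall_mem_Icc [Nonempty X] {f : X → ℝ} {D : ℝ} (h : ∀ x y, f x - f y ≤ D) :
    ∃ lo, ∀ x, lo ≤ f x ∧ f x ≤ lo + D := by
  obtain ⟨x₀⟩ := ‹Nonempty X›
  have hb : BddBelow (Set.range f) := ⟨f x₀ - D, by rintro _ ⟨y, rfl⟩; linarith [h x₀ y]⟩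
  have : Nonempty X := ⟨x₀⟩
  refine ⟨⨅ x, f x, fun x => ⟨ciInf_le hb x, ?_⟩⟩
  rw [← sub_le_iff_le_add]
  exact le_ciInf fun y => by linarith [h x y]

/-! ### Finite fibres, and the normalised operators as weighted averages -/

namespace System

variable [MetricSpace X] [CompactSpace X] (S : System X ι)

/-- Two preimages of `x` in one ball of radius `a / 2` coincide, and finitely many such balls cover
`X`. -/
theorem finite_preimage (i : ι) (x : X) : (S.T i ⁻¹' {x}).Finite := by
  obtain ⟨t, -, ht, hc⟩ := finite_cover_balls_of_compact (isCompact_univ (X := X))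
    (half_pos S.a_pos)
  refine (ht.biUnion (t := fun c => S.T i ⁻¹' {x} ∩ Metric.ball c (S.a / 2))
    fun c _ => Set.Subsingleton.finite ?_).subset fun y hy => ?_
  · rintro y ⟨hy, hyc⟩ z ⟨hz, hzc⟩
    have hy' : S.T i y = x := hy
    have hz' : S.T i z = x := hz
    have hd : dist y z < S.a := by
      have := dist_triangle_right y z c
      rw [Metric.mem_ball] at hyc hzc
      linarith
    exact eq_of_dist_lt (hy'.trans hz'.symm) (by simpa using S.a_pos) hd (by simpa using S.a_pos)
  · obtain ⟨c, hct, hyc⟩ := Set.mem_iUnion₂.1 (hc (Set.mem_univ y))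
    exact Set.mem_biUnion hct ⟨hy, hyc⟩

theorem finite_wordMap_preimage (w : List ι) (x : X) : (wordMap S.T w ⁻¹' {x}).Finite := by
  induction w with
  | nil => exact Set.finite_singleton x
  | cons i w ih =>
    refine (ih.biUnion fun y _ => S.finite_preimage i y).subset fun z hz => ?_
    exact Set.mem_biUnion (show S.T i z ∈ wordMap S.T w ⁻¹' {x} from hz) rfl

/-- The finite set of preimages of `x` under `T_w`. -/
def fiber (w : List ι) (x : X) : Finset X := (S.finite_wordMap_preimage w x).toFinset

@[simp]
theorem mem_fiber {w : List ι} {x y : X} : y ∈ S.fiber w x ↔ wordMap S.T w y = x := by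
  simp [fiber]

theorem fiber_nonempty (w : List ι) (x : X) : (S.fiber w x).Nonempty := by
  obtain ⟨y, hy⟩ := S.surjective_wordMap w x
  exact ⟨y, S.mem_fiber.2 hy⟩

theorem L_eq_sum (w : List ι) (f : X → ℝ) (x : X) :
    S.L w f x = ∑ y ∈ S.fiber w x, Real.exp (S.wordPot w y) * f y := by
  have h := Finset.tsum_subtype' (S.fiber w x) fun y => Real.exp (S.wordPot w y) * f y
  rw [← h]
  unfold fiber
  rw [Set.Finite.coe_toFinset]
  rfl

theorem L_append (u v : List ι) (f : X → ℝ) (x : X) :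
    S.L (u ++ v) f x = S.L v (S.L u f) x := by
  classical
  rw [L_eq_sum, L_eq_sum, ← Finset.sum_fiberwise_of_maps_to (t := S.fiber v x)
    (g := wordMap S.T u) fun z hz => ?_]
  · refine Finset.sum_congr rfl fun y hy => ?_
    rw [L_eq_sum, Finset.mul_sum]
    refine Finset.sum_congr ?_ fun z hz => ?_
    · ext z
      rw [mem_fiber] at hy
      simp only [Finset.mem_filter, mem_fiber, wordMap_append]
      exact ⟨fun h => h.2, fun h => ⟨by rw [h, hy], h⟩⟩
    · rw [mem_fiber] at hz
      rw [wordPot_append, Real.exp_add, hz]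
      ring
  · rw [mem_fiber, wordMap_append] at hz
    exact S.mem_fiber.2 hz

/-- The function `L_w 1`. -/
def Z (w : List ι) (x : X) : ℝ := S.L w (fun _ => 1) x

theorem Z_eq_sum (w : List ι) (x : X) :
    S.Z w x = ∑ y ∈ S.fiber w x, Real.exp (S.wordPot w y) := by
  simp [Z, L_eq_sum]

theorem Z_pos (w : List ι) (x : X) : 0 < S.Z w x := by
  rw [Z_eq_sum]
  exact Finset.sum_pos (fun y _ => Real.exp_pos _) (S.fiber_nonempty w x)

theorem Z_append (u v : List ι) (x : X) :
    S.Z (u ++ v) x = ∑ y ∈ S.fiber v x, Real.exp (S.wordPot v y) * S.Z u y := by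
  rw [Z, L_append, L_eq_sum]
  rfl

/-- The weight which `ℙ_u^v` at `x` gives to the preimage `y` of `x`. -/
def weight (u v : List ι) (x y : X) : ℝ :=
  Real.exp (S.wordPot v y) * S.Z u y / S.Z (u ++ v) x

theorem weight_pos (u v : List ι) (x y : X) : 0 < S.weight u v x y :=
  div_pos (mul_pos (Real.exp_pos _) (S.Z_pos u y)) (S.Z_pos _ x)

theorem sum_weight (u v : List ι) (x : X) : ∑ y ∈ S.fiber v x, S.weight u v x y = 1 := by
  simp only [weight]
  rw [← Finset.sum_div, ← Z_append, div_self (S.Z_pos _ x).ne']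

theorem P_eq_sum (u v : List ι) (f : X → ℝ) (x : X) :
    S.P u v f x = ∑ y ∈ S.fiber v x, S.weight u v x y * f y := by
  rw [P, L_eq_sum, Finset.sum_div]
  refine Finset.sum_congr rfl fun y _ => ?_
  simp only [weight, Z]
  ring

/-- The normaliser `Z (u ++ v)` of the inner average cancels against the weight of the outer one.
Thus extending `v` on the right averages once more, with `v` absorbed into the past. -/
theorem P_append (u v w : List ι) (f : X → ℝ) (x : X) :
    S.P u (v ++ w) f x = S.P (u ++ v) w (S.P u v f) x := by
  rw [P, P, List.append_assoc, L_append]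
  congr 2
  funext y
  rw [P, div_mul_cancel₀]
  exact (S.Z_pos _ y).ne'

theorem P_mem_Icc (u v : List ι) {f : X → ℝ} {lo hi : ℝ} (hlo : ∀ y, lo ≤ f y)
    (hhi : ∀ y, f y ≤ hi) (x : X) : lo ≤ S.P u v f x ∧ S.P u v f x ≤ hi := by
  have h := S.sum_weight u v x
  rw [P_eq_sum]
  constructor
  · calc lo = ∑ y ∈ S.fiber v x, S.weight u v x y * lo := by rw [← Finset.sum_mul, h, one_mul]
      _ ≤ _ := Finset.sum_le_sum fun y _ => mul_le_mul_of_nonneg_left (hlo y) (S.weight_pos _ _ _ _).le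
  · calc _ ≤ ∑ y ∈ S.fiber v x, S.weight u v x y * hi := Finset.sum_le_sum fun y _ =>
          mul_le_mul_of_nonneg_left (hhi y) (S.weight_pos _ _ _ _).le
      _ = hi := by rw [← Finset.sum_mul, h, one_mul]

/-! ### Distortion of the weights -/

/-- Nearby points have nearby preimages. -/
theorem exists_matching (w : List ι) {x x' : X} (h : dist x x' < S.a) :
    ∃ e : X → X, Set.InjOn e (S.fiber w x) ∧ ∀ y ∈ S.fiber w x, e y ∈ S.fiber w x' ∧
      dist y (e y) ≤ dist x x' ∧
      Real.exp (S.wordPot w y) ≤ Real.exp (S.distortionAt x x') * Real.exp (S.wordPot w (e y)) := by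
  have H : ∀ y : X, ∃ z, y ∈ S.fiber w x → wordMap S.T w z = x' ∧ S.Matched w y z := by
    intro y
    by_cases hy : y ∈ S.fiber w x
    · obtain ⟨z, hz⟩ := S.exists_matched w (x := y) (y := x') (by rwa [S.mem_fiber.1 hy])
      exact ⟨z, fun _ => hz⟩
    · exact ⟨y, fun h => absurd h hy⟩
  choose e he using H
  refine ⟨e, fun y hy z hz hyz => ?_, fun y hy => ?_⟩
  · have h1 := (he y hy).2.symm
    rw [hyz] at h1
    exact h1.eq_of_wordMap_eq (he z hz).2.symm
      ((S.mem_fiber.1 hy).trans (S.mem_fiber.1 hz).symm)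
  · obtain ⟨h1, h2⟩ := he y hy
    refine ⟨S.mem_fiber.2 h1, ?_, ?_⟩
    · have := h2.dist_le
      rw [h1, S.mem_fiber.1 hy] at this
      exact this.trans (mul_le_of_le_one_left dist_nonneg (S.lam_pow_le_one _))
    · have := h2.abs_wordPot_sub_le
      rw [h1, S.mem_fiber.1 hy] at this
      rw [← Real.exp_add, Real.exp_le_exp]
      have := (abs_le.1 this).2
      unfold distortionAt
      linarith

theorem Z_le_of_dist_lt (w : List ι) {x x' : X} (h : dist x x' < S.a) :
    S.Z w x ≤ Real.exp (S.distortionAt x x') * S.Z w x' := by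
  classical
  obtain ⟨e, he, h1⟩ := S.exists_matching w h
  rw [Z_eq_sum, Z_eq_sum, Finset.mul_sum]
  calc _ ≤ ∑ y ∈ S.fiber w x, Real.exp (S.distortionAt x x') * Real.exp (S.wordPot w (e y)) :=
        Finset.sum_le_sum fun y hy => (h1 y hy).2.2
    _ = ∑ z ∈ (S.fiber w x).image e, Real.exp (S.distortionAt x x') * Real.exp (S.wordPot w z) :=
        (Finset.sum_image (f := fun z => Real.exp (S.distortionAt x x') *
          Real.exp (S.wordPot w z)) he).symm
    _ ≤ _ := Finset.sum_le_sum_of_subset_of_nonneg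
        (Finset.image_subset_iff.2 fun y hy => (h1 y hy).1) fun z _ _ => by positivity

/-- A proportion `exp (-3E)` of the mass is moved along the matching of fibres, which changes `f` by
at most `ε`; the rest costs at most `D`. The three factors `exp E` are the distortions of `exp
(wordPot v)`, of `Z u` and of the normaliser `Z (u ++ v)`. -/
theorem P_sub_le_of_dist_lt (u v : List ι) {x x' : X} (h : dist x x' < S.a) {f : X → ℝ}
    {ε lo D : ℝ} (hε : ∀ y y', dist y y' ≤ dist x x' → f y - f y' ≤ ε) (hε0 : 0 ≤ ε)
    (hlo : ∀ y, lo ≤ f y) (hhi : ∀ y, f y ≤ lo + D) :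
    S.P u v f x - S.P u v f x' ≤ ε + (1 - Real.exp (-(3 * S.distortionAt x x'))) * D := by
  obtain ⟨e, he, h1⟩ := S.exists_matching v h
  set E := S.distortionAt x x' with hE
  have hE0 : 0 ≤ E := S.distortionAt_nonneg _ _
  have hle : Real.exp (-(3 * E)) ≤ 1 := Real.exp_le_one_iff.2 (by linarith)
  have hs : ∑ y ∈ S.fiber v x, Real.exp (-(3 * E)) * S.weight u v x y = Real.exp (-(3 * E)) := by
    rw [← Finset.mul_sum, sum_weight, mul_one]
  rw [P_eq_sum, P_eq_sum]
  refine (sum_mul_sub_sum_mul_le (S.fiber v x) (S.fiber v x) (S.fiber v x') (a := id) (b := e)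
    (m := fun y => Real.exp (-(3 * E)) * S.weight u v x y) (Set.injOn_id _) he (fun _ h => h)
    (fun y hy => (h1 y hy).1) (fun _ _ => (S.weight_pos _ _ _ _).le)
    (fun _ _ => (S.weight_pos _ _ _ _).le) (S.sum_weight u v x) (S.sum_weight u v x')
    (fun y _ => mul_le_of_le_one_left (S.weight_pos _ _ _ _).le hle) (fun y hy => ?_) hlo hhi).trans ?_
  · obtain ⟨h2, h3, h4⟩ := h1 y hy
    have h5 : S.Z u y ≤ Real.exp E * S.Z u (e y) :=
      (S.Z_le_of_dist_lt u (h3.trans_lt h)).trans (mul_le_mul_of_nonneg_right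
        (Real.exp_le_exp.2 (S.distortionAt_mono h3)) (S.Z_pos _ _).le)
    have h6 : S.Z (u ++ v) x' ≤ Real.exp E * S.Z (u ++ v) x := by
      rw [hE, distortionAt_comm]
      exact S.Z_le_of_dist_lt _ (by rwa [dist_comm])
    have hexp : Real.exp (-(3 * E)) * (Real.exp E * Real.exp E * Real.exp E) = 1 := by
      rw [← Real.exp_add, ← Real.exp_add, ← Real.exp_add, Real.exp_eq_one_iff]
      ring
    simp only [weight]
    rw [← mul_div_assoc, div_le_div_iff₀ (S.Z_pos _ _) (S.Z_pos _ _)]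
    calc _ ≤ Real.exp (-(3 * E)) * ((Real.exp E * Real.exp (S.wordPot v (e y))) *
          (Real.exp E * S.Z u (e y))) * (Real.exp E * S.Z (u ++ v) x) := by
          have := S.Z_pos u y
          have := S.Z_pos (u ++ v) x'
          have := S.Z_pos u (e y)
          gcongr
      _ = (Real.exp (-(3 * E)) * (Real.exp E * Real.exp E * Real.exp E)) *
          (Real.exp (S.wordPot v (e y)) * S.Z u (e y) * S.Z (u ++ v) x) := by ring
      _ = _ := by rw [hexp, one_mul]
  · rw [hs]
    refine add_le_add_left ?_ _
    calc _ ≤ ∑ y ∈ S.fiber v x, Real.exp (-(3 * E)) * S.weight u v x y * ε :=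
          Finset.sum_le_sum fun y hy => mul_le_mul_of_nonneg_left (hε _ _ (h1 y hy).2.1)
            (mul_nonneg (Real.exp_pos _).le (S.weight_pos _ _ _ _).le)
      _ = Real.exp (-(3 * E)) * ε := by rw [← Finset.sum_mul, hs]
      _ ≤ ε := mul_le_of_le_one_left hε0 hle

end System

/-- Uniform equicontinuity of a set of real functions. -/
def Equicont [MetricSpace X] (F : Set (X → ℝ)) : Prop :=
  ∀ ε > 0, ∃ η > 0, ∀ f ∈ F, ∀ x y, dist x y < η → f x - f y ≤ ε

theorem Equicont.continuous [MetricSpace X] {F : Set (X → ℝ)} (hF : Equicont F) {f : X → ℝ}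
    (hf : f ∈ F) : Continuous f := by
  rw [Metric.continuous_iff]
  intro x ε hε
  obtain ⟨η, hη, h⟩ := hF (ε / 2) (half_pos hε)
  refine ⟨η, hη, fun y hy => ?_⟩
  have h1 := h f hf y x hy
  have h2 := h f hf x y (by rwa [dist_comm])
  rw [Real.dist_eq, abs_lt]
  constructor <;> linarith

theorem equicont_singleton [MetricSpace X] [CompactSpace X] {f : X → ℝ} (hf : Continuous f) :
    Equicont {f} := by
  intro ε hε
  obtain ⟨η, hη, h⟩ := Metric.uniformContinuous_iff.1
    (CompactSpace.uniformContinuous_of_continuous hf) ε hε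
  refine ⟨η, hη, ?_⟩
  rintro _ rfl x y hxy
  have := h hxy
  rw [Real.dist_eq] at this
  exact (le_abs_self _).trans this.le

namespace System

variable [MetricSpace X] (S : System X ι)

theorem continuous_pot : Continuous S.pot := by
  rw [continuous_iff_continuousAt]
  intro x
  rw [ContinuousAt, tendsto_iff_norm_sub_tendsto_zero]
  refine squeeze_zero (fun _ => norm_nonneg _) (fun y => S.abs_pot_sub_le y x) ?_
  have h : Continuous fun y => S.coeff * dist y x ^ S.alpha :=
    continuous_const.mul ((continuous_id.dist continuous_const).rpow_const
      fun _ => Or.inr S.alpha_pos.le)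
  simpa [Real.zero_rpow S.alpha_pos.ne'] using h.tendsto x

theorem continuous_wordPot (w : List ι) : Continuous (S.wordPot w) := by
  induction w with
  | nil => exact continuous_const
  | cons i w ih => exact S.continuous_pot.add (ih.comp (S.continuous_T i))

theorem exists_distortion_le (D : ℝ) {ε : ℝ} (hε : 0 < ε) :
    ∃ η > 0, ∀ x y, dist x y < η → (1 - Real.exp (-(3 * S.distortionAt x y))) * D ≤ ε := by
  have h : Continuous fun t : ℝ => (1 - Real.exp (-(3 * (S.distortion * t ^ S.alpha)))) * D := by
    have : Continuous fun t : ℝ => t ^ S.alpha :=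
      continuous_id.rpow_const fun _ => Or.inr S.alpha_pos.le
    fun_prop
  have h0 := h.tendsto 0
  simp only [Real.zero_rpow S.alpha_pos.ne', mul_zero, neg_zero, Real.exp_zero, sub_self,
    zero_mul] at h0
  obtain ⟨η, hη, H⟩ := Metric.eventually_nhds_iff.1 (h0.eventually (eventually_lt_nhds hε))
  refine ⟨η, hη, fun x y hxy => (H ?_).le⟩
  rwa [Real.dist_eq, sub_zero, abs_of_nonneg dist_nonneg]

variable [CompactSpace X]

/-- The distortion bounds do not involve the words, so one modulus serves all `u` and `v`. -/
theorem equicont_P {F : Set (X → ℝ)} (hF : Equicont F) {M : ℝ} (hM : ∀ f ∈ F, ∀ x, |f x| ≤ M) :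
    Equicont {g | ∃ f ∈ F, ∃ u v, g = S.P u v f} := by
  intro ε hε
  obtain ⟨η₁, hη₁, h₁⟩ := hF (ε / 2) (half_pos hε)
  obtain ⟨η₂, hη₂, h₂⟩ := S.exists_distortion_le (2 * M) (half_pos hε)
  refine ⟨min S.a (min η₁ η₂), lt_min S.a_pos (lt_min hη₁ hη₂), ?_⟩
  rintro _ ⟨f, hf, u, v, rfl⟩ x y hxy
  have h3 := S.P_sub_le_of_dist_lt u v (hxy.trans_le (min_le_left _ _)) (f := f) (ε := ε / 2)
    (lo := -M) (D := 2 * M) (fun z z' hz => h₁ f hf z z' ?_) (half_pos hε).le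
    (fun z => (abs_le.1 (hM f hf z)).1) (fun z => by linarith [(abs_le.1 (hM f hf z)).2])
  · have h4 := h₂ x y (hxy.trans_le ((min_le_right _ _).trans (min_le_right _ _)))
    linarith
  · exact hz.trans_lt (hxy.trans_le ((min_le_right _ _).trans (min_le_left _ _)))

theorem continuous_P (u v : List ι) {f : X → ℝ} (hf : Continuous f) : Continuous (S.P u v f) := by
  obtain ⟨M, hM⟩ := isCompact_univ.exists_bound_of_continuousOn hf.continuousOn
  exact (S.equicont_P (equicont_singleton hf) (M := M)
    (by rintro _ rfl x; exact hM x (Set.mem_univ x))).continuous ⟨f, rfl, u, v, rfl⟩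

/-! ### Consequences of mixing -/

/-- Mixing yields a point `p` near `z` with image within `a` of `x`; shadowing replaces `p` by a
true preimage at distance at most `λ ^ n * a`. Two finite covers leave only finitely many pairs of
balls, which makes `N` uniform. -/
theorem exists_preimage_near {η : ℝ} (hη : 0 < η) :
    ∃ N : ℕ, ∀ w : List ι, N ≤ w.length → ∀ x z, ∃ y ∈ S.fiber w x, dist y z < η := by
  have hη3 : 0 < η / 3 := by positivity
  obtain ⟨t, -, ht, htc⟩ := finite_cover_balls_of_compact (isCompact_univ (X := X)) (half_pos S.a_pos)
  obtain ⟨s, -, hs, hsc⟩ := finite_cover_balls_of_compact (isCompact_univ (X := X)) hη3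
  have hm := fun c c' : X => S.mixing (Metric.ball c (S.a / 2)) (Metric.ball c' (η / 3))
    Metric.isOpen_ball ⟨c, Metric.mem_ball_self (half_pos S.a_pos)⟩
    Metric.isOpen_ball ⟨c', Metric.mem_ball_self hη3⟩
  choose m hm using hm
  obtain ⟨n, hn⟩ : ∃ n : ℕ, S.lam ^ n * S.a < η / 3 := by
    have := (tendsto_pow_atTop_nhds_zero_of_lt_one S.lam_pos.le S.lam_lt_one).mul_const S.a
    rw [zero_mul] at this
    exact (this.eventually (eventually_lt_nhds hη3)).exists
  refine ⟨max n ((ht.toFinset ×ˢ hs.toFinset).sup fun q => m q.1 q.2), fun w hw x z => ?_⟩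
  obtain ⟨c, hct, hc⟩ := Set.mem_iUnion₂.1 (htc (Set.mem_univ x))
  obtain ⟨c', hcs, hc'⟩ := Set.mem_iUnion₂.1 (hsc (Set.mem_univ z))
  have hmw : m c c' ≤ w.length := by
    refine le_trans ?_ ((le_max_right _ _).trans hw)
    exact Finset.le_sup (f := fun q : X × X => m q.1 q.2) (b := (c, c'))
      (Finset.mem_product.2 ⟨ht.mem_toFinset.2 hct, hs.mem_toFinset.2 hcs⟩)
  obtain ⟨p, hp, hp'⟩ := hm c c' w hmw
  rw [Set.mem_preimage, Metric.mem_ball] at hp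
  rw [Metric.mem_ball] at hc hc' hp'
  have hd : dist (wordMap S.T w p) x < S.a := by
    linarith [dist_triangle_right (wordMap S.T w p) x c]
  obtain ⟨y, hy, hpy⟩ := S.exists_matched w hd
  refine ⟨y, S.mem_fiber.2 hy, ?_⟩
  have h1 : dist p y ≤ S.lam ^ n * S.a := by
    refine hpy.dist_le.trans ?_
    rw [hy]
    exact mul_le_mul (pow_le_pow_of_le_one S.lam_pos.le S.lam_lt_one.le
      ((le_max_left _ _).trans hw)) hd.le dist_nonneg (pow_nonneg S.lam_pos.le _)
  have h2 := dist_triangle y p z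
  have h3 := dist_triangle_right p z c'
  rw [dist_comm y p] at h2
  linarith

theorem exists_Z_le (w : List ι) : ∃ B, ∀ x, S.Z w x ≤ B := by
  obtain ⟨t, -, ht, htc⟩ := finite_cover_balls_of_compact (isCompact_univ (X := X)) S.a_pos
  refine ⟨∑ c ∈ ht.toFinset, Real.exp (S.distortion * S.a ^ S.alpha) * S.Z w c, fun x => ?_⟩
  obtain ⟨c, hct, hc⟩ := Set.mem_iUnion₂.1 (htc (Set.mem_univ x))
  rw [Metric.mem_ball] at hc
  refine (S.Z_le_of_dist_lt w hc).trans ((mul_le_mul_of_nonneg_right (Real.exp_le_exp.2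
    (mul_le_mul_of_nonneg_left (Real.rpow_le_rpow dist_nonneg hc.le S.alpha_pos.le)
    S.distortion_nonneg)) (S.Z_pos _ _).le).trans ?_)
  exact Finset.single_le_sum (f := fun c => Real.exp (S.distortion * S.a ^ S.alpha) * S.Z w c)
    (fun c _ => (mul_pos (Real.exp_pos _) (S.Z_pos w c)).le) (ht.mem_toFinset.2 hct)

variable [Finite ι]

/-- There are only finitely many words of length `N`, so bounds for single words become uniform. -/
theorem exists_bounds (N : ℕ) : ∃ B > 0, ∀ w : List ι, w.length = N → ∀ x,
    S.Z w x ≤ B ∧ 1 ≤ B * Real.exp (S.wordPot w x) := by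
  have H : ∀ w : List ι, ∃ B > 0, ∀ x, S.Z w x ≤ B ∧ 1 ≤ B * Real.exp (S.wordPot w x) := by
    intro w
    obtain ⟨B, hB⟩ := S.exists_Z_le w
    obtain ⟨C, hC⟩ := (isCompact_range (S.continuous_wordPot w)).bddBelow
    refine ⟨max B (Real.exp (-C)), lt_max_of_lt_right (Real.exp_pos _), fun x =>
      ⟨(hB x).trans (le_max_left _ _), ?_⟩⟩
    calc (1 : ℝ) ≤ Real.exp (-C) * Real.exp (S.wordPot w x) := by
          rw [← Real.exp_add, Real.one_le_exp_iff]
          linarith [hC ⟨x, rfl⟩]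
      _ ≤ _ := mul_le_mul_of_nonneg_right (le_max_right _ _) (Real.exp_pos _).le
  choose B hB0 hB using H
  have hfin := (List.finite_length_eq ι N)
  refine ⟨1 + ∑ w ∈ hfin.toFinset, B w, add_pos_of_pos_of_nonneg one_pos
    (Finset.sum_nonneg fun w _ => (hB0 w).le), fun w hw x => ?_⟩
  have h1 : B w ≤ 1 + ∑ w ∈ hfin.toFinset, B w := by
    have := Finset.single_le_sum (f := B) (fun w _ => (hB0 w).le) (hfin.mem_toFinset.2 hw)
    linarith
  exact ⟨(hB w x).1.trans h1, (hB w x).2.trans (mul_le_mul_of_nonneg_right h1 (Real.exp_pos _).le)⟩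

/-- A Harnack inequality uniform in the word. For long words the last `N` letters are split off, and
mixing over them links any two points; words shorter than `N` fall under the crude bounds. -/
theorem exists_Z_le_mul : ∃ K > 0, ∀ (u : List ι) x y, S.Z u x ≤ K * S.Z u y := by
  choose B hB0 hB using S.exists_bounds
  obtain ⟨N, hN⟩ := S.exists_preimage_near S.a_pos
  set E := Real.exp (S.distortion * S.a ^ S.alpha) with hE
  have hE0 : 0 < E := Real.exp_pos _
  have hlow : ∀ (v : List ι) y, 1 ≤ B v.length * S.Z v y := by
    intro v y
    obtain ⟨z, hz⟩ := S.fiber_nonempty v y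
    refine (hB _ v rfl z).2.trans (mul_le_mul_of_nonneg_left ?_ (hB0 _).le)
    rw [Z_eq_sum]
    exact Finset.single_le_sum (f := fun z => Real.exp (S.wordPot v z))
      (fun _ _ => (Real.exp_pos _).le) hz
  have hsum : ∀ n, 0 ≤ B n * B n := fun n => mul_self_nonneg _
  refine ⟨E * (B N * B N) + ∑ n ∈ Finset.range N, B n * B n, add_pos_of_pos_of_nonneg
    (mul_pos hE0 (mul_pos (hB0 N) (hB0 N))) (Finset.sum_nonneg fun n _ => hsum n),
    fun u x y => ?_⟩
  rcases lt_or_ge u.length N with hu | hu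
  · calc S.Z u x ≤ B u.length := (hB _ u rfl x).1
      _ ≤ B u.length * (B u.length * S.Z u y) := le_mul_of_one_le_right (hB0 _).le (hlow u y)
      _ = (B u.length * B u.length) * S.Z u y := (mul_assoc _ _ _).symm
      _ ≤ _ := by
        refine mul_le_mul_of_nonneg_right ?_ (S.Z_pos _ _).le
        have := Finset.single_le_sum (f := fun n => B n * B n) (fun n _ => hsum n)
          (Finset.mem_range.2 hu)
        have := mul_pos hE0 (mul_pos (hB0 N) (hB0 N))
        linarith
  · obtain ⟨u₁, u₂, rfl, hu₂⟩ : ∃ u₁ u₂ : List ι, u = u₁ ++ u₂ ∧ u₂.length = N :=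
      ⟨u.take (u.length - N), u.drop (u.length - N), (List.take_append_drop _ _).symm,
        by rw [List.length_drop]; omega⟩
    -- Some `u₂`-preimage `t` of `y` lies within `a` of `z`; distortion compares `Z u₁ z` with `Z u₁
    -- t`, which enters a single term of `Z (u₁ ++ u₂) y`.
    have h1 : ∀ z, S.Z u₁ z ≤ E * B N * S.Z (u₁ ++ u₂) y := by
      intro z
      obtain ⟨t, ht, htz⟩ := hN u₂ hu₂.ge y z
      rw [dist_comm] at htz
      calc S.Z u₁ z ≤ Real.exp (S.distortionAt z t) * S.Z u₁ t := S.Z_le_of_dist_lt u₁ htz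
        _ ≤ E * S.Z u₁ t := mul_le_mul_of_nonneg_right (Real.exp_le_exp.2
            (mul_le_mul_of_nonneg_left (Real.rpow_le_rpow dist_nonneg htz.le S.alpha_pos.le)
            S.distortion_nonneg)) (S.Z_pos _ _).le
        _ ≤ E * ((B N * Real.exp (S.wordPot u₂ t)) * S.Z u₁ t) :=
            mul_le_mul_of_nonneg_left (le_mul_of_one_le_left (S.Z_pos _ _).le
              (hB N u₂ hu₂ t).2) hE0.le
        _ = E * B N * (Real.exp (S.wordPot u₂ t) * S.Z u₁ t) := by ring
        _ ≤ _ := by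
          refine mul_le_mul_of_nonneg_left ?_ (mul_pos hE0 (hB0 N)).le
          rw [Z_append]
          exact Finset.single_le_sum (f := fun t => Real.exp (S.wordPot u₂ t) * S.Z u₁ t)
            (fun t _ => (mul_pos (Real.exp_pos _) (S.Z_pos _ _)).le) ht
    have hK : 0 ≤ E * B N * S.Z (u₁ ++ u₂) y :=
      (mul_pos (mul_pos hE0 (hB0 N)) (S.Z_pos _ _)).le
    calc S.Z (u₁ ++ u₂) x ≤ S.Z u₂ x * (E * B N * S.Z (u₁ ++ u₂) y) := by
          rw [Z_append, S.Z_eq_sum u₂, Finset.sum_mul]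
          exact Finset.sum_le_sum fun z _ => mul_le_mul_of_nonneg_left (h1 z) (Real.exp_pos _).le
      _ ≤ B N * (E * B N * S.Z (u₁ ++ u₂) y) :=
          mul_le_mul_of_nonneg_right (hB N u₂ hu₂ x).1 hK
      _ = E * (B N * B N) * S.Z (u₁ ++ u₂) y := by ring
      _ ≤ _ := mul_le_mul_of_nonneg_right
          (le_add_of_nonneg_right (Finset.sum_nonneg fun n _ => hsum n)) (S.Z_pos _ _).le

/-- The minorisation for the Doeblin argument: the Harnack constant `K` removes the unbounded word
`u`, leaving quantities that depend only on words of length `N`. -/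
theorem exists_le_weight (N : ℕ) : ∃ δ > 0, ∀ (u v : List ι) x, v.length = N →
    ∀ y ∈ S.fiber v x, δ ≤ S.weight u v x y := by
  obtain ⟨K, hK, hZ⟩ := S.exists_Z_le_mul
  obtain ⟨B, hB0, hB⟩ := S.exists_bounds N
  refine ⟨(K * B * B)⁻¹, by positivity, fun u v x hv y hy => ?_⟩
  rw [weight, inv_eq_one_div, div_le_div_iff₀ (by positivity) (S.Z_pos _ _), one_mul]
  have hu := S.Z_pos u y
  calc S.Z (u ++ v) x ≤ S.Z v x * (K * S.Z u y) := by
        rw [Z_append, S.Z_eq_sum v, Finset.sum_mul]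
        exact Finset.sum_le_sum fun z _ => mul_le_mul_of_nonneg_left (hZ _ _ _) (Real.exp_pos _).le
    _ ≤ B * (K * S.Z u y) := mul_le_mul_of_nonneg_right (hB v hv x).1 (by positivity)
    _ ≤ B * (K * S.Z u y) * (B * Real.exp (S.wordPot v y)) :=
        le_mul_of_one_le_right (by positivity) (hB v hv y).2
    _ = _ := by ring

/-! ### Decay of oscillations -/

theorem exists_P_sub_le [Nonempty X] {F : Set (X → ℝ)} (hF : Equicont F) {M : ℝ}
    (hM : ∀ f ∈ F, ∀ x, |f x| ≤ M) {ε : ℝ} (hε : 0 < ε) :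
    ∃ N, ∀ f ∈ F, ∀ u v : List ι, N ≤ v.length → ∀ x y, S.P u v f x - S.P u v f y ≤ ε := by
  obtain ⟨η, hη, hP⟩ := S.equicont_P hF hM (ε / 2) (half_pos hε)
  obtain ⟨N, hN⟩ := S.exists_preimage_near (half_pos hη)
  obtain ⟨δ', hδ', hw'⟩ := S.exists_le_weight N
  obtain ⟨δ, hδ, hδ1, hw⟩ : ∃ δ > 0, δ ≤ 1 ∧ ∀ (u v : List ι) x, v.length = N →
      ∀ y ∈ S.fiber v x, δ ≤ S.weight u v x y :=
    ⟨min δ' 1, lt_min hδ' one_pos, min_le_right _ _,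
      fun u v x hv y hy => (min_le_left _ _).trans (hw' u v x hv y hy)⟩
  -- Each block of `N` letters turns an oscillation bound `D` into `δ * (ε / 2) + (1 - δ) * D`,
  -- whose fixed point is `ε / 2`.
  have key : ∀ k : ℕ, ∀ f ∈ F, ∀ u v : List ι, v.length = k * N → ∀ x y,
      S.P u v f x - S.P u v f y ≤ 2 * M * (1 - δ) ^ k + ε / 2 := by
    intro k
    induction k with
    | zero =>
      intro f hf u v _ x y
      have h := S.P_mem_Icc u v (fun z => (abs_le.1 (hM f hf z)).1)
        (fun z => (abs_le.1 (hM f hf z)).2)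
      linarith [(h x).2, (h y).1, pow_zero (1 - δ)]
    | succ k ih =>
      intro f hf u v hv x x'
      obtain ⟨v₁, v₂, rfl, hv₁, hv₂⟩ : ∃ v₁ v₂ : List ι, v = v₁ ++ v₂ ∧ v₁.length = k * N ∧
          v₂.length = N :=
        ⟨v.take (k * N), v.drop (k * N), (List.take_append_drop _ _).symm,
          by rw [List.length_take, hv, add_mul, one_mul]; omega,
          by rw [List.length_drop, hv, add_mul, one_mul]; omega⟩
      set D := 2 * M * (1 - δ) ^ k + ε / 2 with hD
      obtain ⟨lo, hlo⟩ := exists_forall_mem_Icc (ih f hf u v₁ hv₁)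
      -- Both preimages are taken within `η / 2` of one common point, here `x`, hence within `η` of
      -- each other.
      obtain ⟨y, hy, hyx⟩ := hN v₂ hv₂.ge x x
      obtain ⟨y', hy', hyx'⟩ := hN v₂ hv₂.ge x' x
      have h1 := sum_mul_sub_sum_mul_le ({()} : Finset Unit) (S.fiber v₂ x) (S.fiber v₂ x')
        (p := S.weight (u ++ v₁) v₂ x) (q := S.weight (u ++ v₁) v₂ x') (f := S.P u v₁ f)
        (a := fun _ => y) (b := fun _ => y') (m := fun _ => δ) (lo := lo) (D := D)
        (by simp) (by simp) (fun _ _ => hy) (fun _ _ => hy')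
        (fun _ _ => (S.weight_pos _ _ _ _).le) (fun _ _ => (S.weight_pos _ _ _ _).le)
        (S.sum_weight _ _ _) (S.sum_weight _ _ _) (fun _ _ => hw _ _ _ hv₂ _ hy)
        (fun _ _ => hw _ _ _ hv₂ _ hy') (fun z => (hlo z).1) (fun z => (hlo z).2)
      rw [← P_eq_sum, ← P_eq_sum, ← P_append, ← P_append] at h1
      simp only [Finset.sum_singleton] at h1
      have h2 : S.P u v₁ f y - S.P u v₁ f y' ≤ ε / 2 := by
        refine hP _ ⟨f, hf, u, v₁, rfl⟩ y y' ?_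
        linarith [dist_triangle_right y y' x]
      calc _ ≤ δ * (ε / 2) + (1 - δ) * D :=
            h1.trans (add_le_add_left (mul_le_mul_of_nonneg_left h2 hδ.le) _)
        _ = _ := by rw [hD, pow_succ]; ring
  obtain ⟨k, hk⟩ : ∃ k : ℕ, 2 * M * (1 - δ) ^ k < ε / 2 := by
    have := (tendsto_pow_atTop_nhds_zero_of_lt_one (sub_nonneg.2 hδ1)
      (sub_lt_self 1 hδ)).const_mul (2 * M)
    rw [mul_zero] at this
    exact (this.eventually (eventually_lt_nhds (half_pos hε))).exists
  refine ⟨k * N, fun f hf u v hv x y => ?_⟩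
  have h3 := key k f hf u (v.take (k * N)) (by rw [List.length_take]; omega)
  obtain ⟨lo, hlo⟩ := exists_forall_mem_Icc h3
  -- Letters beyond the first `k * N` only average further, so they cannot increase the oscillation.
  have h4 := S.P_mem_Icc (u ++ v.take (k * N)) (v.drop (k * N)) (fun z => (hlo z).1)
    (fun z => (hlo z).2)
  simp only [← P_append, List.take_append_drop] at h4
  linarith [(h4 x).2, (h4 y).1]

end System

namespace System

variable [MetricSpace X] {S : System X ι}

/-! ### The Abelian case -/

theorem wordPair_append_comm (hcomm : ∀ p ∈ S.G, ∀ q ∈ S.G, p * q = q * p) (u v : List ι) :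
    S.wordPair (u ++ v) = S.wordPair (v ++ u) := by
  -- The empty word need not give an element of the semigroup, so it is treated apart.
  rcases eq_or_ne u [] with rfl | hu
  · simp
  rcases eq_or_ne v [] with rfl | hv
  · simp
  rw [wordPair_append, wordPair_append]
  exact hcomm _ (S.wordPair_mem_G hv) _ (S.wordPair_mem_G hu)

theorem L_append_comm (hcomm : ∀ p ∈ S.G, ∀ q ∈ S.G, p * q = q * p) (u v : List ι) :
    S.L (u ++ v) = S.L (v ++ u) := by
  unfold L
  rw [wordPair_append_comm hcomm]

theorem P_append_comm (hcomm : ∀ p ∈ S.G, ∀ q ∈ S.G, p * q = q * p) (u v w : List ι) :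
    S.P u (v ++ w) = S.P u (w ++ v) := by
  have h : S.L (u ++ (v ++ w)) = S.L (u ++ (w ++ v)) := by
    rw [L, L, S.wordPair_append u, S.wordPair_append u, wordPair_append_comm hcomm v w]
  funext f x
  rw [P, P, L_append_comm hcomm v w, h]

variable [CompactSpace X] (S)

theorem L_nil (f : X → ℝ) : S.L [] f = f := by
  funext x
  have h : S.fiber [] x = {x} := by
    ext y
    simp [wordMap]
  simp [L_eq_sum, h, wordPot]

/-- With empty past the average of `Z u'` is a quotient of two `Z` functions; this carries
oscillation decay over to ratios. The constant `c` allows normalisation to a bounded family. -/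
theorem P_nil_Z (u u' : List ι) (c : ℝ) (x : X) :
    S.P [] u (fun y => S.Z u' y / c) x = S.Z (u' ++ u) x / (c * S.Z u x) := by
  have h : S.L u (fun y => S.Z u' y / c) x = S.Z (u' ++ u) x / c := by
    rw [L_eq_sum, Z_append, Finset.sum_div]
    exact Finset.sum_congr rfl fun y _ => (mul_div_assoc _ _ _).symm
  simp only [P, L_nil, mul_one, List.nil_append]
  rw [h, div_div]
  rfl

variable [Finite ι] {S}

/-- The value of `P u (v ++ v') f` at `x` lies within `ε / 2` of `P u v f x`, being an average of
it; after commuting, the value lies within `ε / 2` of `P u v' f x'`. -/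
theorem exists_P_sub_P_le_right [Nonempty X] (hcomm : ∀ p ∈ S.G, ∀ q ∈ S.G, p * q = q * p)
    {F : Set (X → ℝ)} (hF : Equicont F) {M : ℝ} (hM : ∀ f ∈ F, ∀ x, |f x| ≤ M)
    {ε : ℝ} (hε : 0 < ε) :
    ∃ N, ∀ f ∈ F, ∀ u v v' : List ι, N ≤ v.length → N ≤ v'.length → ∀ x x',
      S.P u v f x - S.P u v' f x' ≤ ε := by
  obtain ⟨N, hN⟩ := S.exists_P_sub_le hF hM (half_pos hε)
  refine ⟨N, fun f hf u v v' hv hv' x x' => ?_⟩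
  have h1 := (S.P_mem_Icc (u ++ v) v' (f := S.P u v f) (lo := S.P u v f x - ε / 2)
    (hi := S.P u v f x + ε / 2) (fun y => by linarith [hN f hf u v hv x y])
    (fun y => by linarith [hN f hf u v hv y x]) x).1
  have h2 := (S.P_mem_Icc (u ++ v') v (f := S.P u v' f) (lo := S.P u v' f x' - ε / 2)
    (hi := S.P u v' f x' + ε / 2) (fun y => by linarith [hN f hf u v' hv' x' y])
    (fun y => by linarith [hN f hf u v' hv' y x']) x).2
  rw [← P_append] at h1 h2
  rw [P_append_comm hcomm] at h2
  linarith

/-- For long words, the functions `L_u 1` are nearly proportional to each other. -/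
theorem exists_Z_mul_Z_le [Nonempty X] (hcomm : ∀ p ∈ S.G, ∀ q ∈ S.G, p * q = q * p)
    {ε : ℝ} (hε : 0 < ε) :
    ∃ N, ∀ u u' : List ι, N ≤ u.length → N ≤ u'.length → ∀ x y,
      S.Z u x * S.Z u' y ≤ (1 + ε) ^ 2 * (S.Z u' x * S.Z u y) := by
  obtain ⟨K, hK, hZ⟩ := S.exists_Z_le_mul
  obtain ⟨x₀⟩ := ‹Nonempty X›
  have : Nonempty X := ⟨x₀⟩
  -- Normalised at `x₀`, the functions `Z u` take values in `[1 / K, K]` and are equicontinuous, so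
  -- oscillation decay applies uniformly in `u`.
  have hF : Equicont {f : X → ℝ | ∃ u : List ι, f = fun x => S.Z u x / S.Z u x₀} := by
    intro ε' hε'
    obtain ⟨η, hη, h⟩ := S.exists_distortion_le K hε'
    refine ⟨min η S.a, lt_min hη S.a_pos, ?_⟩
    rintro _ ⟨u, rfl⟩ x y hxy
    refine le_trans ?_ (h x y (hxy.trans_le (min_le_left _ _)))
    set E := S.distortionAt x y with hE
    have hE0 : 0 ≤ E := S.distortionAt_nonneg x y
    have h1 := S.Z_le_of_dist_lt u (hxy.trans_le (min_le_right _ _))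
    have h2 : Real.exp (-(3 * E)) * S.Z u x ≤ S.Z u y := by
      calc _ ≤ Real.exp (-(3 * E)) * (Real.exp E * S.Z u y) :=
            mul_le_mul_of_nonneg_left h1 (Real.exp_pos _).le
        _ = Real.exp (-(3 * E) + E) * S.Z u y := by rw [Real.exp_add, mul_assoc]
        _ ≤ _ := mul_le_of_le_one_left (S.Z_pos _ _).le (Real.exp_le_one_iff.2 (by linarith))
    have h3 : Real.exp (-(3 * E)) ≤ 1 := Real.exp_le_one_iff.2 (by linarith)
    rw [← sub_div, div_le_iff₀ (S.Z_pos _ _), mul_assoc]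
    calc S.Z u x - S.Z u y ≤ (1 - Real.exp (-(3 * E))) * S.Z u x := by linarith
      _ ≤ _ := mul_le_mul_of_nonneg_left (hZ u x x₀) (sub_nonneg.2 h3)
  -- The averages are at least `1 / K`, so an additive error `ε / K` becomes a multiplicative factor
  -- `1 + ε`.
  obtain ⟨N, hN⟩ := S.exists_P_sub_le hF (M := K) (by
    rintro _ ⟨u, rfl⟩ x
    have := S.Z_pos u x
    have := S.Z_pos u x₀
    rw [abs_of_nonneg (by positivity), div_le_iff₀ this]
    exact hZ u x x₀) (ε := ε / K) (by positivity)
  have key : ∀ u u' : List ι, N ≤ u.length → ∀ x y,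
      S.Z (u' ++ u) x * S.Z u y ≤ (1 + ε) * (S.Z (u' ++ u) y * S.Z u x) := by
    intro u u' hu x y
    have h1 := hN _ ⟨u', rfl⟩ [] u hu x y
    have h0 := (S.P_mem_Icc [] u (f := fun z => S.Z u' z / S.Z u' x₀) (lo := 1 / K) (hi := K)
      (fun z => by
        rw [div_le_div_iff₀ hK (S.Z_pos _ _), one_mul, mul_comm]
        exact hZ u' x₀ z)
      (fun z => by
        rw [div_le_iff₀ (S.Z_pos _ _)]
        exact hZ u' z x₀) y).1
    have h2 : S.P [] u (fun z => S.Z u' z / S.Z u' x₀) x ≤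
        (1 + ε) * S.P [] u (fun z => S.Z u' z / S.Z u' x₀) y := by
      have : ε / K ≤ ε * S.P [] u (fun z => S.Z u' z / S.Z u' x₀) y := by
        rw [div_eq_mul_one_div]
        exact mul_le_mul_of_nonneg_left h0 hε.le
      linarith
    rw [P_nil_Z, P_nil_Z] at h2
    have hc := S.Z_pos u' x₀
    have hx := S.Z_pos u x
    have hy := S.Z_pos u y
    rw [← mul_div_assoc, div_le_div_iff₀ (by positivity) (by positivity)] at h2
    refine le_of_mul_le_mul_left ?_ hc
    linarith
  refine ⟨N, fun u u' hu hu' x y => ?_⟩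
  have hZc : ∀ z, S.Z (u ++ u') z = S.Z (u' ++ u) z := fun z => by
    unfold Z
    rw [L_append_comm hcomm]
  have hx := S.Z_pos (u' ++ u) x
  have hy := S.Z_pos (u' ++ u) y
  have := S.Z_pos u x
  have := S.Z_pos u y
  have := S.Z_pos u' x
  have := S.Z_pos u' y
  -- Two opposite uses of `key`; since the two concatenations have the same `Z`, its values cancel
  -- in the product, leaving two factors `1 + ε`.
  have h1 := key u' u hu' x y
  have h2 := key u u' hu y x
  rw [hZc, hZc] at h1
  refine le_of_mul_le_mul_left (a := S.Z (u' ++ u) y * S.Z (u' ++ u) x) ?_ (by positivity)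
  calc _ = (S.Z (u' ++ u) y * S.Z u x) * (S.Z (u' ++ u) x * S.Z u' y) := by ring
    _ ≤ ((1 + ε) * (S.Z (u' ++ u) x * S.Z u y)) * ((1 + ε) * (S.Z (u' ++ u) y * S.Z u' x)) :=
        mul_le_mul h2 h1 (by positivity) (by positivity)
    _ = _ := by ring

/-- The weights involve `u` only through ratios of values of `Z u`, so near proportionality of `Z u`
and `Z u'` makes the weights comparable up to `(1 + c) ^ 2`, whatever `v` is. -/
theorem exists_P_sub_P_le_left [Nonempty X] (hcomm : ∀ p ∈ S.G, ∀ q ∈ S.G, p * q = q * p)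
    {f : X → ℝ} {M : ℝ} (hM : ∀ x, |f x| ≤ M) {ε : ℝ} (hε : 0 < ε) :
    ∃ N, ∀ u u' v : List ι, N ≤ u.length → N ≤ u'.length → ∀ x,
      S.P u v f x - S.P u' v f x ≤ ε := by
  obtain ⟨c, hc, hc'⟩ : ∃ c > 0, (1 - ((1 + c) ^ 2)⁻¹) * (2 * M) ≤ ε := by
    have h : ContinuousAt (fun c : ℝ => (1 - ((1 + c) ^ 2)⁻¹) * (2 * M)) 0 := by
      refine ContinuousAt.mul (continuousAt_const.sub (ContinuousAt.inv₀ ?_ (by norm_num)))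
        continuousAt_const
      fun_prop
    have h0 := h.tendsto
    norm_num at h0
    obtain ⟨η, hη, H⟩ := Metric.eventually_nhds_iff.1 (h0.eventually (eventually_lt_nhds hε))
    refine ⟨η / 2, half_pos hη, (H (y := η / 2) ?_).le⟩
    rw [Real.dist_eq, sub_zero, abs_of_pos (half_pos hη)]
    exact half_lt_self hη
  obtain ⟨N, hN⟩ := exists_Z_mul_Z_le hcomm hc
  refine ⟨N, fun u u' v hu hu' x => ?_⟩
  have hw : ∀ y, ((1 + c) ^ 2)⁻¹ * S.weight u v x y ≤ S.weight u' v x y := by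
    intro y
    rw [inv_mul_le_iff₀ (by positivity), weight, weight, ← mul_div_assoc,
      div_le_div_iff₀ (S.Z_pos _ _) (S.Z_pos _ _), S.Z_append u', S.Z_append u,
      Finset.mul_sum, Finset.mul_sum]
    refine Finset.sum_le_sum fun z _ => ?_
    calc _ = Real.exp (S.wordPot v y) * Real.exp (S.wordPot v z) * (S.Z u y * S.Z u' z) := by ring
      _ ≤ Real.exp (S.wordPot v y) * Real.exp (S.wordPot v z) *
          ((1 + c) ^ 2 * (S.Z u' y * S.Z u z)) :=
        mul_le_mul_of_nonneg_left (hN u u' hu hu' y z) (by positivity)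
      _ = _ := by ring
  have hle : ((1 + c) ^ 2)⁻¹ ≤ 1 := inv_le_one_of_one_le₀ (one_le_pow₀ (by linarith))
  rw [P_eq_sum, P_eq_sum]
  refine (sum_mul_sub_sum_mul_le (S.fiber v x) (S.fiber v x) (S.fiber v x) (a := id) (b := id)
    (m := fun y => ((1 + c) ^ 2)⁻¹ * S.weight u v x y) (lo := -M) (D := 2 * M)
    (Set.injOn_id _) (Set.injOn_id _) (fun _ h => h) (fun _ h => h)
    (fun _ _ => (S.weight_pos _ _ _ _).le) (fun _ _ => (S.weight_pos _ _ _ _).le)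
    (S.sum_weight u v x) (S.sum_weight u' v x)
    (fun y _ => mul_le_of_le_one_left (S.weight_pos _ _ _ _).le hle) (fun y _ => hw y)
    (fun z => (abs_le.1 (hM z)).1) (fun z => by linarith [(abs_le.1 (hM z)).2])).trans ?_
  rw [← Finset.mul_sum, sum_weight, mul_one]
  simpa using hc'

theorem exists_P_sub_P_le [Nonempty X] (hcomm : ∀ p ∈ S.G, ∀ q ∈ S.G, p * q = q * p)
    {f : X → ℝ} (hf : Continuous f) {ε : ℝ} (hε : 0 < ε) :
    ∃ N, ∀ u v u' v' : List ι, N ≤ u.length → N ≤ v.length → N ≤ u'.length → N ≤ v'.length →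
      ∀ x x', S.P u v f x - S.P u' v' f x' ≤ ε := by
  obtain ⟨M, hM⟩ := isCompact_univ.exists_bound_of_continuousOn hf.continuousOn
  have hM' : ∀ x, |f x| ≤ M := fun x => hM x (Set.mem_univ x)
  obtain ⟨N₁, h₁⟩ := exists_P_sub_P_le_right hcomm (equicont_singleton hf)
    (by rintro _ rfl x; exact hM' x) (half_pos hε)
  obtain ⟨N₂, h₂⟩ := exists_P_sub_P_le_left hcomm hM' (half_pos hε)
  refine ⟨max N₁ N₂, fun u v u' v' hu hv hu' hv' x x' => ?_⟩
  have h3 := h₁ f rfl u v v' ((le_max_left _ _).trans hv) ((le_max_left _ _).trans hv') x x'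
  have h4 := h₂ u u' v' ((le_max_right _ _).trans hu) ((le_max_right _ _).trans hu') x'
  linarith

end System

/-! ### The common limit measure -/

namespace System

section Equilibrium

variable [MetricSpace X] [MeasurableSpace X] {S : System X ι}

theorem isEquilibriumState_iff {μ : ProbabilityMeasure X}
    (hμ : ∀ (σ ω : ℕ → ι) (ν : ProbabilityMeasure X), S.IsQuenchedLimit σ ω ν ↔ ν = μ)
    {p : Pair X} (hp : p ∈ S.G) (ν : ProbabilityMeasure X) :
    S.IsEquilibriumState p ν ↔ ν = μ := by
  constructor
  · rintro ⟨w, hw, -, h⟩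
    exact (hμ _ _ ν).1 h
  · rintro rfl
    obtain ⟨w, hw, rfl⟩ := S.exists_word_of_mem_G hp
    exact ⟨w, hw, rfl, (hμ _ _ ν).2 rfl⟩

theorem eqState_eq [Nonempty X] {p : Pair X} {μ : ProbabilityMeasure X}
    (hμ : ∀ ν, S.IsEquilibriumState p ν ↔ ν = μ) : S.eqState p = μ :=
  (hμ _).1 (Classical.epsilon_spec_aux _ _ ⟨μ, (hμ μ).2 rfl⟩)

end Equilibrium

section Limit

variable [MetricSpace X] [CompactSpace X] [MeasurableSpace X] [BorelSpace X] (S : System X ι)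

/-- Realising the averages as integrals makes compactness of the space of probability measures
available. -/
theorem exists_probabilityMeasure_P (u v : List ι) (x : X) :
    ∃ ν : ProbabilityMeasure X, ∀ f : X → ℝ, Continuous f →
      ∫ y, f y ∂(ν : Measure X) = S.P u v f x := by
  refine ⟨⟨∑ y ∈ S.fiber v x, ENNReal.ofReal (S.weight u v x y) • Measure.dirac y, ⟨?_⟩⟩,
    fun f hf => ?_⟩
  · simp only [Measure.coe_finsetSum, Finset.sum_apply, Measure.smul_apply, measure_univ,
      smul_eq_mul, mul_one]
    rw [← ENNReal.ofReal_sum_of_nonneg fun y _ => (S.weight_pos u v x y).le, sum_weight,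
      ENNReal.ofReal_one]
  · rw [P_eq_sum, ProbabilityMeasure.coe_mk, integral_finsetSum_measure]
    · refine Finset.sum_congr rfl fun y _ => ?_
      rw [integral_smul_measure, integral_dirac, ENNReal.toReal_ofReal (S.weight_pos _ _ _ _).le,
        smul_eq_mul]
    · intro y _
      exact (integrable_dirac (by simp)).smul_measure ENNReal.ofReal_ne_top

variable [Finite ι] [Nonempty ι] [Nonempty X] {S}

theorem exists_limit (hcomm : ∀ p ∈ S.G, ∀ q ∈ S.G, p * q = q * p) :
    ∃ μ : ProbabilityMeasure X, ∀ f : X → ℝ, Continuous f → ∀ ε > 0, ∃ N, ∀ u v : List ι,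
      N ≤ u.length → N ≤ v.length → ∀ x, |S.P u v f x - ∫ y, f y ∂(μ : Measure X)| ≤ ε := by
  obtain ⟨i⟩ := ‹Nonempty ι›
  obtain ⟨x₀⟩ := ‹Nonempty X›
  have : Nonempty X := ⟨x₀⟩
  choose ν hν using fun n : ℕ =>
    S.exists_probabilityMeasure_P (List.replicate n i) (List.replicate n i) x₀
  -- A limit along one ultrafilter suffices: the uniform estimate forces all other long words
  -- towards the same values.
  obtain ⟨μ, -, hμ⟩ := (isCompact_univ (X := ProbabilityMeasure X)).ultrafilter_le_nhds
    ((hyperfilter ℕ).map ν) (by simp)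
  have hlim : Tendsto ν (hyperfilter ℕ : Filter ℕ) (𝓝 μ) := hμ
  rw [ProbabilityMeasure.tendsto_iff_forall_integral_tendsto] at hlim
  refine ⟨μ, fun f hf ε hε => ?_⟩
  have h1 : Tendsto (fun n => S.P (List.replicate n i) (List.replicate n i) f x₀)
      (hyperfilter ℕ : Filter ℕ) (𝓝 (∫ y, f y ∂(μ : Measure X))) := by
    have := hlim (BoundedContinuousFunction.mkOfCompact ⟨f, hf⟩)
    simpa [hν _ f hf] using this
  obtain ⟨N, hN⟩ := exists_P_sub_P_le hcomm hf hε
  have hev : ∀ᶠ n in (hyperfilter ℕ : Filter ℕ), N ≤ n :=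
    Nat.hyperfilter_le_atTop (eventually_ge_atTop N)
  refine ⟨N, fun u v hu hv x => abs_le.2 ⟨?_, ?_⟩⟩
  · have := le_of_tendsto h1 (b := S.P u v f x + ε) (hev.mono fun n hn => by
      have := hN (List.replicate n i) (List.replicate n i) u v (by simpa) (by simpa) hu hv x₀ x
      linarith)
    linarith
  · have := ge_of_tendsto h1 (b := S.P u v f x - ε) (hev.mono fun n hn => by
      have := hN u v (List.replicate n i) (List.replicate n i) hu hv (by simpa) (by simpa) x x₀
      linarith)
    linarith

theorem exists_isQuenchedLimit_iff (hcomm : ∀ p ∈ S.G, ∀ q ∈ S.G, p * q = q * p) :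
    ∃ μ : ProbabilityMeasure X, ∀ (σ ω : ℕ → ι) (ν : ProbabilityMeasure X),
      S.IsQuenchedLimit σ ω ν ↔ ν = μ := by
  obtain ⟨μ, hμ⟩ := exists_limit hcomm
  have h : ∀ σ ω : ℕ → ι, S.IsQuenchedLimit σ ω μ := by
    intro σ ω ν f hf
    rw [Metric.tendsto_atTop]
    intro ε hε
    obtain ⟨N, hN⟩ := hμ f hf (ε / 2) (half_pos hε)
    refine ⟨(N, N), fun n hn => ?_⟩
    have h1 := hN (leftWord σ n.1) (rightWord ω n.2) (by simpa [leftWord] using hn.1)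
      (by simpa [rightWord] using hn.2)
    set c := ∫ y, f y ∂(μ : Measure X)
    set g := S.P (leftWord σ n.1) (rightWord ω n.2) f
    have hg : Integrable g (ν : Measure X) :=
      (S.continuous_P _ _ hf).integrable_of_hasCompactSupport (HasCompactSupport.of_compactSpace _)
    have h2 : ∫ x, g x ∂(ν : Measure X) - c = ∫ x, (g x - c) ∂(ν : Measure X) := by
      rw [integral_sub hg (integrable_const c)]
      simp
    rw [Real.dist_eq, h2, ← Real.norm_eq_abs]
    refine (norm_integral_le_of_norm_le_const (C := ε / 2) (Eventually.of_forall h1)).trans_lt ?_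
    simpa using hε
  refine ⟨μ, fun σ ω ν => ⟨fun hν => ?_, fun e => e ▸ h σ ω⟩⟩
  refine Subtype.ext (ext_of_forall_integral_eq_of_IsFiniteMeasure
    (μ := (ν : Measure X)) (ν := (μ : Measure X)) fun f => ?_)
  -- Both limits are tested on the same initial measure `μ`.
  exact tendsto_nhds_unique (hν μ f f.continuous) (h σ ω μ f f.continuous)

end Limit

/-! ### The expansion constant -/

section Expansion

variable [MetricSpace X] [CompactSpace X] (S : System X ι)

theorem exists_matched_of_dist_lt (w : List ι) : ∃ ε > 0, ∀ x y, dist x y < ε → S.Matched w x y := by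
  induction w with
  | nil => exact ⟨S.a, S.a_pos, fun x y h => h⟩
  | cons i w ih =>
    obtain ⟨ε, hε, h⟩ := ih
    obtain ⟨η, hη, hi⟩ := Metric.uniformContinuous_iff.1
      (CompactSpace.uniformContinuous_of_continuous (S.continuous_T i)) ε hε
    exact ⟨min S.a η, lt_min S.a_pos hη, fun x y hxy =>
      ⟨hxy.trans_le (min_le_left _ _), h _ _ (hi (hxy.trans_le (min_le_right _ _)))⟩⟩

/-- Sufficiently close points have matched orbits along `w`, and matched orbits separate by at least
`λ ^ (-|w|)`. -/
theorem le_kappa (w : List ι) :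
    ENNReal.ofReal (S.lam ^ w.length)⁻¹ ≤ kappa (wordMap S.T w) := by
  obtain ⟨ε, hε, h⟩ := S.exists_matched_of_dist_lt w
  refine le_iSup₂_of_le (ENNReal.ofReal ε) (ENNReal.ofReal_pos.2 hε) ?_
  refine le_iInf fun x => le_iInf fun y => le_iInf fun hxy => le_iInf fun hlt => ?_
  rw [edist_dist] at hlt
  have hlt' : dist x y < ε := (ENNReal.ofReal_lt_ofReal_iff hε).1 hlt
  rw [ENNReal.le_div_iff_mul_le (Or.inl hxy.ne') (Or.inl (edist_ne_top x y)), edist_dist,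
    edist_dist, ← ENNReal.ofReal_mul (inv_nonneg.2 (pow_nonneg S.lam_pos.le _))]
  refine ENNReal.ofReal_le_ofReal ?_
  rw [inv_mul_le_iff₀ (pow_pos S.lam_pos _)]
  exact (h x y hlt').dist_le

theorem toReal_inv_kappa_le (w : List ι) :
    (kappa (wordMap S.T w))⁻¹.toReal ≤ S.lam ^ w.length := by
  have h := ENNReal.inv_le_inv.2 (S.le_kappa w)
  rw [← ENNReal.ofReal_inv_of_pos (inv_pos.2 (pow_pos S.lam_pos _)), inv_inv] at h
  exact ENNReal.toReal_le_of_le_ofReal (pow_nonneg S.lam_pos.le _) h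

theorem toReal_inv_kappa_pos (w : List ι) (h : kappa (wordMap S.T w) ≠ ⊤) :
    0 < (kappa (wordMap S.T w))⁻¹.toReal := by
  refine ENNReal.toReal_pos (ENNReal.inv_ne_zero.2 h) (ENNReal.inv_ne_top.2 ?_)
  refine ((ENNReal.ofReal_pos.2 (inv_pos.2 (pow_pos S.lam_pos _))).trans_le (S.le_kappa w)).ne'

end Expansion

/-! ### The boundary -/

section Boundary

variable [MetricSpace X] (S : System X ι)

theorem dstar_self (x : X) : S.dstar x x = 0 := by
  simp [dstar, Real.zero_rpow S.alpha_pos.ne']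

variable [MeasurableSpace X] [BorelSpace X] [CompactSpace X]

theorem Wbar_self (μ : ProbabilityMeasure X) : S.Wbar μ μ = 0 := by
  refine le_antisymm (csInf_le (S.Wbar_bddBelow μ μ)
    ⟨(μ : Measure X).map fun x => (x, x), ⟨?_, ?_, ?_⟩, ?_⟩) (S.Wbar_nonneg μ μ)
  · exact Measure.isProbabilityMeasure_map (by fun_prop)
  · rw [Measure.map_map measurable_fst (by fun_prop)]
    exact Measure.map_id
  · rw [Measure.map_map measurable_snd (by fun_prop)]
    exact Measure.map_id
  · show ∫ q, S.dstar q.1 q.2 ∂(Measure.map (fun x => (x, x)) (μ : Measure X)) = 0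
    rw [integral_map (by fun_prop) S.continuous_dstar.measurable.aestronglyMeasurable]
    simp [dstar_self]

variable [Nonempty X] {S}

theorem exists_boundary_eq_singleton [Nonempty ι] {μ : ProbabilityMeasure X}
    (hμ : ∀ p ∈ S.G, S.eqState p = μ) (hk : ∀ p ∈ S.G, kappa p.map ≠ ⊤) :
    ∃ z : UniformSpace.Completion S.G, S.boundary = {z} := by
  obtain ⟨r, hr⟩ : ∃ r : S.G → ℝ, ∀ p, r p = (kappa (p : Pair X).map)⁻¹.toReal := ⟨_, fun _ => rfl⟩
  have hr0 : ∀ p, 0 < r p := by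
    intro p
    obtain ⟨w, -, hw⟩ := S.exists_word_of_mem_G p.2
    have hmap : (p : Pair X).map = wordMap S.T w := congrArg Pair.map hw
    rw [hr, hmap]
    exact S.toReal_inv_kappa_pos w (hmap ▸ hk p p.2)
  have hdist : ∀ p q : S.G, p ≠ q → dist p q = r p + r q := by
    intro p q h
    show S.distG p q = _
    rw [distG, if_neg h, hμ p p.2, hμ q q.2, Wbar_self, zero_add, hr, hr]
  have hle : ∀ p q : S.G, dist p q ≤ r p + r q := by
    intro p q
    by_cases h : p = q
    · rw [h, dist_self]
      exact (add_pos (hr0 q) (hr0 q)).le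
    · exact (hdist p q h).le
  obtain ⟨i⟩ := ‹Nonempty ι›
  -- The exponent `n + 1` keeps the words non-empty.
  set s : ℕ → S.G := fun n =>
    ⟨S.wordPair (List.replicate (n + 1) i), S.wordPair_mem_G (by simp)⟩ with hs
  have hrs : Tendsto (fun n => r (s n)) atTop (𝓝 0) := by
    refine squeeze_zero (fun n => (hr0 _).le) (fun n => ?_)
      ((tendsto_add_atTop_iff_nat 1).2
        (tendsto_pow_atTop_nhds_zero_of_lt_one S.lam_pos.le S.lam_lt_one))
    have h := S.toReal_inv_kappa_le (List.replicate (n + 1) i)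
    rw [List.length_replicate] at h
    rw [hr]
    exact h
  have hcs : CauchySeq fun n => (s n : UniformSpace.Completion S.G) := by
    refine (UniformSpace.Completion.uniformContinuous_coe S.G).comp_cauchySeq ?_
    rw [Metric.cauchySeq_iff']
    intro ε hε
    obtain ⟨N, hN⟩ := (hrs.eventually (eventually_lt_nhds (half_pos hε))).exists_forall_of_atTop
    exact ⟨N, fun n hn => by linarith [hle (s n) (s N), hN n hn, hN N le_rfl]⟩
  obtain ⟨z, hz⟩ := cauchySeq_tendsto_of_complete hcs
  -- A boundary point is never attained, so after `p` a strictly closer `q ≠ p` exists; then `r p +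
  -- r q = dist p q` is small, which bounds `r p`.
  have small : ∀ y ∈ S.boundary, ∀ ε > 0, ∃ p : S.G, dist y p < ε ∧ r p < ε := by
    intro y hy ε hε
    obtain ⟨p, hp⟩ := UniformSpace.Completion.denseRange_coe.exists_dist_lt y (half_pos hε)
    have hyp : 0 < dist y p := dist_pos.2 fun h => hy ⟨p, h.symm⟩
    obtain ⟨q, hq⟩ := UniformSpace.Completion.denseRange_coe.exists_dist_lt y
      (lt_min hyp (half_pos hε))
    have hne : p ≠ q := by
      rintro rfl
      exact lt_irrefl _ (hq.trans_le (min_le_left _ _))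
    have h1 := dist_triangle_left (p : UniformSpace.Completion S.G) q y
    rw [UniformSpace.Completion.dist_eq, hdist p q hne] at h1
    exact ⟨p, by linarith, by linarith [hr0 q, hq.trans_le (min_le_right _ _)]⟩
  -- Points closer than `r p` to `p` equal `p`; the sequence cannot end there, because `r (s n)`
  -- drops below `r p`.
  have hzb : z ∈ S.boundary := by
    rintro ⟨p, rfl⟩
    have h1 : Tendsto (fun n => dist (s n : UniformSpace.Completion S.G) p) atTop (𝓝 0) :=
      tendsto_iff_dist_tendsto_zero.1 hz
    obtain ⟨n, hn, hn'⟩ := ((h1.eventually (eventually_lt_nhds (hr0 p))).and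
      (hrs.eventually (eventually_lt_nhds (hr0 p)))).exists
    rw [UniformSpace.Completion.dist_eq] at hn
    by_cases h : s n = p
    · rw [h] at hn'
      exact lt_irrefl _ hn'
    · rw [hdist _ _ h] at hn
      linarith [hr0 (s n)]
  refine ⟨z, Set.eq_singleton_iff_unique_mem.2 ⟨hzb, fun y hy => ?_⟩⟩
  refine eq_of_forall_dist_le fun ε hε => ?_
  obtain ⟨p, hp, hp'⟩ := small y hy (ε / 4) (by positivity)
  obtain ⟨q, hq, hq'⟩ := small z hzb (ε / 4) (by positivity)
  have h1 := dist_triangle y (p : UniformSpace.Completion S.G) z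
  have h2 := dist_triangle_right (p : UniformSpace.Completion S.G) z q
  rw [UniformSpace.Completion.dist_eq] at h2
  linarith [hle p q]

end Boundary

end System

end RuelleSemigroup

end

theorem mainTheorem11 {X : Type*} {ι : Type*} [MetricSpace X] [CompactSpace X] [Nonempty X]
    [MeasurableSpace X] [BorelSpace X] [Finite ι] [Nonempty ι]
    (S : RuelleSemigroup.System X ι)
    (hcomm : ∀ p ∈ S.G, ∀ q ∈ S.G, p * q = q * p) :
    (∃ μ : MeasureTheory.ProbabilityMeasure X,
      (∀ p ∈ S.G, (∀ ν : MeasureTheory.ProbabilityMeasure X, S.IsEquilibriumState p ν ↔ ν = μ) ∧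
        S.eqState p = μ) ∧
      (∀ (σ ω : ℕ → ι) (ν : MeasureTheory.ProbabilityMeasure X),
        S.IsQuenchedLimit σ ω ν ↔ ν = μ)) ∧
    ((∀ p ∈ S.G, RuelleSemigroup.kappa p.map ≠ ⊤) →
      ∃ z : UniformSpace.Completion S.G, S.boundary = {z}) := by
  obtain ⟨μ, hμ⟩ := RuelleSemigroup.System.exists_isQuenchedLimit_iff hcomm
  have h := fun p hp => RuelleSemigroup.System.isEquilibriumState_iff (p := p) hμ hp
  have h' := fun p hp => RuelleSemigroup.System.eqState_eq (h p hp)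
  exact ⟨⟨μ, fun p hp => ⟨h p hp, h' p hp⟩, hμ⟩,
    RuelleSemigroup.System.exists_boundary_eq_singleton h'⟩
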